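/- **Setting.** Let $I$ be a set and $A=(a_{ij})_{i,j\in I}$ an integer matrix with $a_{ii}\in\{2,0,-2,-4,\dots\}$, $a_{ij}\le 0$ for $i\ne j$, and $d_ia_{ij}=d_ja_{ji}$ for fixed positive integers $d_i$ $(i\in I)$. Let $P$ be a free abelian group, $P^\vee=\operatorname{Hom}(P,\mathbb Z)$, $\alpha_i\in P$ and $h_i\in P^\vee$ $(i\in I)$ with $\langle h_i,\alpha_j\rangle=a_{ij}$, the $\alpha_i$ linearly independent over $\mathbb C$, and suppose that for each $i\in I$ there is $\Lambda_i\in P$ with $\langle h_j,\Lambda_i\rangle=\delta_{ij}$ for all $j$. Let $p:I\to\{0,1\}$ be a parity function such that $a_{ij}\in2\mathbb Z$ for all $j\in I$ whenever $p(i)=1$. Put $I^{re}=\{i: a_{ii}=2\}$, $I^{im}=\{i: a_{ii}\le 0\}$, $I^\infty=(I^{re}\times\{1\})\sqcup(I^{im}\times\mathbb Z_{>0})$, and write $i$ for $(i,1)$. Put $p(li)\equiv l\,p(i)\pmod 2$, $q_i=q^{d_i}$, $K_i^{\pm l}=q^{\pm l d_ih_i}$, and for $a\in\mathbb Z$, $t\in\mathbb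 N$, $$\begin{bmatrix}a\\t\end{bmatrix}_i=\frac{\prod_{s=0}^{t-1}\bigl(((-1)^{p(i)}q_i)^{a-s}-q_i^{s-a}\bigr)}{\prod_{s=1}^{t}\bigl(((-1)^{p(i)}q_i)^{s}-q_i^{-s}\bigr)}\in\mathbb Q(q).$$ The *quantum Borcherds–Bozec superalgebra* $U=U_q(\mathfrak g)$ is the associative unital $\mathbb Q(q)$-superalgebra generated by $a_{il},b_{il}$ $((i,l)\in I^\infty)$, of parity $p(li)$, and $q^h$ $(h\in P^\vee)$, of parity $0$, with defining relations $$q^0=1,\qquad q^hq^{h'}=q^{h+h'},\qquad q^ha_{il}q^{-h}=q^{l\langle h,\alpha_i\rangle}a_{il},\qquad q^hb_{il}q^{-h}=q^{-l\langle h,\alpha_i\rangle}b_{il},$$ $$\sum_{t+t'=1-ka_{ij}}(-1)^{t'}(-1)^{p(i)\left(t'p(kj)+\binom{t'}2\right)}\begin{bmatrix}1-ka_{ij}\\t'\end{bmatrix}_i x_i^{\,t}x_{jk}x_i^{\,t'}=0\quad\text{for } x=a \text{ and for } x=b,\ \ i\in I^{re},\ (j,k)\in I^\infty,\ (i,1)\neq(j,k),$$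 $$a_{il}a_{jk}-(-1)^{p(li)p(kj)}a_{jk}a_{il}=b_{il}b_{jk}-(-1)^{p(li)p(kj)}b_{jk}b_{il}=0\quad\text{if } a_{ij}=0,$$ $$a_{il}b_{jk}-(-1)^{p(li)p(kj)}b_{jk}a_{il}=\delta_{ij}\delta_{kl}\,\frac{K_i^l-K_i^{-l}}{1-(-1)^{p(li)}q_i^{2l}}.$$ Let $U^-$, $U^0$, $U^+$ be the subalgebras of $U$ generated by all $b_{il}$, all $q^h$, and all $a_{il}$, respectively. **Theorem (triangular decomposition).** The multiplication map $$U^-\otimes_{\mathbb Q(q)}U^0\otimes_{\mathbb Q(q)}U^+\longrightarrow U_q(\mathfrak g),\qquad x\otimes y\otimes z\longmapsto xyz,$$ is an isomorphism of $\mathbb Q(q)$-superspaces, that is, it is bijective and $\mathbb Q(q)$-linear and it carries, for each parity, the component of that parity of $U^-\otimes U^0\otimes U^+$ onto the component of that parity of $U_q(\mathfrak g)$. -/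

import Mathlib

open scoped TensorProduct DirectSum

noncomputable section

universe u v

/-- A super Borcherds-Cartan datum: a symmetrizable Borcherds-Cartan matrix `A` over the index set
`I` with its symmetrizer `diag (d i)`, simple roots `root i` in the weight lattice `P`, simple
coroots `coroot i` in the dual weight lattice `P^∨ = Hom(P, ℤ)`, and a parity `p` on `I`. -/
structure SuperBorcherdsCartanDatum (I : Type u) (P : Type v) [AddCommGroup P]
    [Module.Free ℤ P] where
  A : Matrix I I ℤ
  d : I → ℕ
  p : I → ZMod 2
  root : I → P
  coroot : I → Module.Dual ℤ P
  A_diag : ∀ i, A i i = 2 ∨ (A i i ≤ 0 ∧ Even (A i i))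
  A_offDiag : ∀ i j, i ≠ j → A i j ≤ 0
  d_pos : ∀ i, 0 < d i
  symm : ∀ i j, (d i : ℤ) * A i j = (d j : ℤ) * A j i
  pairing : ∀ i j, coroot i (root j) = A i j
  linearIndependent_root :
    LinearIndependent ℂ (fun i => ((1 : ℂ) ⊗ₜ[ℤ] root i : ℂ ⊗[ℤ] P))
  even_of_odd : ∀ i, p i = 1 → ∀ j, Even (A i j)
  exists_fundamentalWeight : ∀ i, ∃ Λ : P, coroot i Λ = 1 ∧ ∀ j, j ≠ i → coroot j Λ = 0

namespace SuperBorcherdsCartanDatum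

variable {I : Type u} {P : Type v} [AddCommGroup P] [Module.Free ℤ P]
  (D : SuperBorcherdsCartanDatum I P)

/-- The set `I^∞ = (I^re × {1}) ⊔ (I^im × ℤ_{>0})`. -/
abbrev IInf : Type u :=
  {x : I × ℕ // (D.A x.1 x.1 = 2 ∧ x.2 = 1) ∨ (D.A x.1 x.1 ≤ 0 ∧ 0 < x.2)}

/-- The element `(i, 1)` of `I^∞` for a real index `i`. -/
def reIdx (i : I) (hi : D.A i i = 2) : D.IInf := ⟨(i, 1), Or.inl ⟨hi, rfl⟩⟩

/-- The parity `p(i)` as one of the natural numbers `0` and `1`. -/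
def pn (i : I) : ℕ := (D.p i).val

/-- The parity `p(li) = l p(i) mod 2` of an element `(i, l)` of `I^∞`, as `0` or `1`. -/
def pInf (x : D.IInf) : ℕ := (x.1.2 * D.pn x.1.1) % 2

/-- `q_i = q ^ d_i` in `ℚ(q)`. -/
def qi (i : I) : RatFunc ℚ := RatFunc.X ^ D.d i

/-- The binomial coefficient `[a; t]_i`, for `a ∈ ℤ` and `t ∈ ℕ`. -/
def qBinom (i : I) (a : ℤ) (t : ℕ) : RatFunc ℚ :=
  (∏ s ∈ Finset.range t,
      (((-1) ^ D.pn i * D.qi i) ^ (a - (s : ℤ)) - D.qi i ^ ((s : ℤ) - a))) /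
    ∏ s ∈ Finset.Icc 1 t,
      (((-1) ^ D.pn i * D.qi i) ^ (s : ℤ) - D.qi i ^ (-(s : ℤ)))

/-- The generators `a_{il}`, `b_{il}` for `(i, l) ∈ I^∞`, and `q^h` for `h ∈ P^∨`. -/
inductive Gen : Type (max u v)
  | a (x : D.IInf)
  | b (x : D.IInf)
  | qpow (h : Module.Dual ℤ P)

/-- The parity of a generator. -/
def genParity : D.Gen → ZMod 2
  | .a x => (D.pInf x : ZMod 2)
  | .b x => (D.pInf x : ZMod 2)
  | .qpow _ => 0

abbrev Free : Type (max u v) := FreeAlgebra (RatFunc ℚ) D.Gen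

def fa (x : D.IInf) : D.Free := FreeAlgebra.ι _ (.a x)

def fb (x : D.IInf) : D.Free := FreeAlgebra.ι _ (.b x)

def fq (h : Module.Dual ℤ P) : D.Free := FreeAlgebra.ι _ (.qpow h)

/-- The left-hand side of the quantum Serre relation for a family `g` of elements indexed by
`I^∞`, a real index `i` and an element `y = (j, k)` of `I^∞`. -/
def serre (g : D.IInf → D.Free) (i : I) (hi : D.A i i = 2) (y : D.IInf) : D.Free :=
  ∑ t ∈ Finset.range ((1 - (y.1.2 : ℤ) * D.A i y.1.1).toNat + 1),
    ((-1) ^ t * (-1) ^ (D.pn i * (t * D.pInf y + t.choose 2)) *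
        D.qBinom i (1 - (y.1.2 : ℤ) * D.A i y.1.1) t : RatFunc ℚ) •
      (g (D.reIdx i hi) ^ ((1 - (y.1.2 : ℤ) * D.A i y.1.1).toNat - t) * g y *
        g (D.reIdx i hi) ^ t)

/-- The supercommutator `g_x g'_y - (-1)^{p(x) p(y)} g'_y g_x`. -/
def superComm (g g' : D.IInf → D.Free) (x y : D.IInf) : D.Free :=
  g x * g' y - ((-1) ^ (D.pInf x * D.pInf y) : RatFunc ℚ) • (g' y * g x)

/-- The defining relations. Here `K_i^l = q^{l d_i h_i}`. -/
inductive Rel : D.Free → D.Free → Prop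
  | q_zero : Rel (D.fq 0) 1
  | q_add (h h' : Module.Dual ℤ P) : Rel (D.fq h * D.fq h') (D.fq (h + h'))
  | q_a (h : Module.Dual ℤ P) (x : D.IInf) :
      Rel (D.fq h * D.fa x * D.fq (-h))
        ((RatFunc.X ^ ((x.1.2 : ℤ) * h (D.root x.1.1)) : RatFunc ℚ) • D.fa x)
  | q_b (h : Module.Dual ℤ P) (x : D.IInf) :
      Rel (D.fq h * D.fb x * D.fq (-h))
        ((RatFunc.X ^ (-((x.1.2 : ℤ) * h (D.root x.1.1))) : RatFunc ℚ) • D.fb x)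
  | serre_a (i : I) (hi : D.A i i = 2) (y : D.IInf) (hy : D.reIdx i hi ≠ y) :
      Rel (D.serre D.fa i hi y) 0
  | serre_b (i : I) (hi : D.A i i = 2) (y : D.IInf) (hy : D.reIdx i hi ≠ y) :
      Rel (D.serre D.fb i hi y) 0
  | comm_a (x y : D.IInf) (hxy : D.A x.1.1 y.1.1 = 0) : Rel (D.superComm D.fa D.fa x y) 0
  | comm_b (x y : D.IInf) (hxy : D.A x.1.1 y.1.1 = 0) : Rel (D.superComm D.fb D.fb x y) 0
  | ab_ne (x y : D.IInf) (hxy : x ≠ y) : Rel (D.superComm D.fa D.fb x y) 0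
  | ab_self (x : D.IInf) :
      Rel (D.superComm D.fa D.fb x x)
        ((1 - (-1) ^ D.pInf x * D.qi x.1.1 ^ (2 * x.1.2) : RatFunc ℚ)⁻¹ •
          (D.fq ((x.1.2 * D.d x.1.1) • D.coroot x.1.1) -
            D.fq (-((x.1.2 * D.d x.1.1) • D.coroot x.1.1))))

/-- The quantum Borcherds-Bozec superalgebra `U_q(𝔤)` over `ℚ(q)`. -/
abbrev U : Type (max u v) := RingQuot D.Rel

def mkU : D.Free →ₐ[RatFunc ℚ] D.U := RingQuot.mkAlgHom (RatFunc ℚ) D.Rel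

/-- The image of a generator in `U_q(𝔤)`. -/
def gen (g : D.Gen) : D.U := D.mkU (FreeAlgebra.ι _ g)

/-- `U^+`, the subalgebra generated by the `a_{il}`. -/
def UPos : Subalgebra (RatFunc ℚ) D.U :=
  Algebra.adjoin (RatFunc ℚ) (Set.range fun x => D.gen (.a x))

/-- `U^-`, the subalgebra generated by the `b_{il}`. -/
def UNeg : Subalgebra (RatFunc ℚ) D.U :=
  Algebra.adjoin (RatFunc ℚ) (Set.range fun x => D.gen (.b x))

/-- `U^0`, the subalgebra generated by the `q^h`. -/
def UZero : Subalgebra (RatFunc ℚ) D.U :=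
  Algebra.adjoin (RatFunc ℚ) (Set.range fun h => D.gen (.qpow h))

/-- The homogeneous component of parity `c` of `U_q(𝔤)`: the span of the words in the generators
whose total parity is `c`. -/
def parity (c : ZMod 2) : Submodule (RatFunc ℚ) D.U :=
  Submodule.span (RatFunc ℚ)
    {u | ∃ w : List D.Gen, (w.map D.genParity).sum = c ∧ (w.map D.gen).prod = u}

/-- The homogeneous component of parity `c` of `U^- ⊗ U^0 ⊗ U^+`. -/
def tensorParity (c : ZMod 2) :
    Submodule (RatFunc ℚ) (D.UNeg ⊗[RatFunc ℚ] (D.UZero ⊗[RatFunc ℚ] D.UPos)) :=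
  Submodule.span (RatFunc ℚ)
    {t | ∃ (c₁ c₂ c₃ : ZMod 2) (x : D.UNeg) (y : D.UZero) (z : D.UPos),
      c₁ + c₂ + c₃ = c ∧ (x : D.U) ∈ D.parity c₁ ∧ (y : D.U) ∈ D.parity c₂ ∧
        (z : D.U) ∈ D.parity c₃ ∧ x ⊗ₜ (y ⊗ₜ z) = t}

lemma gen_mem (g : D.Gen) : D.gen g ∈ D.parity (D.genParity g) :=
  Submodule.subset_span ⟨[g], by simp, by simp⟩

instance : SetLike.GradedMonoid D.parity where
  one_mem := Submodule.subset_span ⟨[], by simp, by simp⟩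
  mul_mem := by
    intro c c' x y hx hy
    have h := Submodule.mul_mem_mul hx hy
    rw [parity, parity, Submodule.span_mul_span] at h
    refine Submodule.span_mono ?_ h
    rintro _ ⟨_, ⟨w, hw, rfl⟩, _, ⟨w', hw', rfl⟩, rfl⟩
    exact ⟨w ++ w', by simp [hw, hw'], by simp⟩

/-- The decomposition map on the free algebra. -/
def freeDec : D.Free →ₐ[RatFunc ℚ] ⨁ c, D.parity c :=
  FreeAlgebra.lift _ fun g => DirectSum.of (fun c => D.parity c) (D.genParity g)
    ⟨D.gen g, D.gen_mem g⟩

lemma coe_freeDec (x : D.Free) :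
    DirectSum.coeAlgHom D.parity (D.freeDec x) = D.mkU x := by
  have : (DirectSum.coeAlgHom D.parity).comp D.freeDec = D.mkU := by
    ext g
    simp [freeDec, gen]
  exact DFunLike.congr_fun this x

/-- The elements of the free algebra that decompose into a single component. -/
def freeHom (c : ZMod 2) : Submodule (RatFunc ℚ) D.Free :=
  (LinearMap.range (DirectSum.lof (RatFunc ℚ) (ZMod 2) (fun c => D.parity c) c)).comap
    D.freeDec.toLinearMap

lemma freeHom_ι (g : D.Gen) : FreeAlgebra.ι (RatFunc ℚ) g ∈ D.freeHom (D.genParity g) :=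
  ⟨⟨D.gen g, D.gen_mem g⟩, by simp [freeDec, DirectSum.lof_eq_of]⟩

instance : SetLike.GradedMonoid D.freeHom where
  one_mem := ⟨⟨1, SetLike.one_mem_graded D.parity⟩, by
    simp only [AlgHom.toLinearMap_apply, DirectSum.lof_eq_of, map_one]; rfl⟩
  mul_mem := by
    rintro c c' x y ⟨u, hu⟩ ⟨v, hv⟩
    refine ⟨⟨u * v, SetLike.mul_mem_graded u.2 v.2⟩, ?_⟩
    simp only [AlgHom.toLinearMap_apply, DirectSum.lof_eq_of, map_mul] at hu hv ⊢
    rw [← hu, ← hv, DirectSum.of_mul_of]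
    rfl

lemma mul_mem_freeHom {c c' : ZMod 2} {x y : D.Free} (hx : x ∈ D.freeHom c)
    (hy : y ∈ D.freeHom c') : x * y ∈ D.freeHom (c + c') := SetLike.mul_mem_graded hx hy

lemma freeHom_serre (g : D.IInf → D.Free) (hg : ∀ x, g x ∈ D.freeHom (D.pInf x : ZMod 2))
    (i : I) (hi : D.A i i = 2) (y : D.IInf) :
    D.serre g i hi y ∈ D.freeHom
      ((1 - (y.1.2 : ℤ) * D.A i y.1.1).toNat • (D.pInf (D.reIdx i hi) : ZMod 2) + D.pInf y) := by
  refine Submodule.sum_mem _ fun t ht => Submodule.smul_mem _ _ ?_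
  have h := D.mul_mem_freeHom (D.mul_mem_freeHom
    (SetLike.pow_mem_graded ((1 - (y.1.2 : ℤ) * D.A i y.1.1).toNat - t) (hg (D.reIdx i hi)))
      (hg y)) (SetLike.pow_mem_graded t (hg (D.reIdx i hi)))
  have ht' : t ≤ (1 - (y.1.2 : ℤ) * D.A i y.1.1).toNat := by
    rw [Finset.mem_range] at ht; omega
  convert h using 1
  conv_lhs => rw [← Nat.sub_add_cancel ht', add_smul]
  abel_nf

lemma freeHom_superComm (g g' : D.IInf → D.Free)
    (hg : ∀ x, g x ∈ D.freeHom (D.pInf x : ZMod 2))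
    (hg' : ∀ x, g' x ∈ D.freeHom (D.pInf x : ZMod 2)) (x y : D.IInf) :
    D.superComm g g' x y ∈ D.freeHom ((D.pInf x : ZMod 2) + D.pInf y) := by
  refine Submodule.sub_mem _ (D.mul_mem_freeHom (hg x) (hg' y)) (Submodule.smul_mem _ _ ?_)
  rw [add_comm]
  exact D.mul_mem_freeHom (hg' y) (hg x)

lemma rel_homogeneous {x y : D.Free} (h : D.Rel x y) :
    ∃ c, x ∈ D.freeHom c ∧ y ∈ D.freeHom c := by
  have ha : ∀ x, D.fa x ∈ D.freeHom (D.pInf x : ZMod 2) := fun x => D.freeHom_ι (.a x)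
  have hb : ∀ x, D.fb x ∈ D.freeHom (D.pInf x : ZMod 2) := fun x => D.freeHom_ι (.b x)
  have hq : ∀ h, D.fq h ∈ D.freeHom 0 := fun h => D.freeHom_ι (.qpow h)
  induction h with
  | q_zero => exact ⟨0, hq 0, SetLike.one_mem_graded _⟩
  | q_add h h' => exact ⟨0, by simpa using D.mul_mem_freeHom (hq h) (hq h'), hq _⟩
  | q_a h x =>
    exact ⟨_, by simpa using D.mul_mem_freeHom (D.mul_mem_freeHom (hq h) (ha x)) (hq (-h)),
      Submodule.smul_mem _ _ (ha x)⟩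
  | q_b h x =>
    exact ⟨_, by simpa using D.mul_mem_freeHom (D.mul_mem_freeHom (hq h) (hb x)) (hq (-h)),
      Submodule.smul_mem _ _ (hb x)⟩
  | serre_a i hi y hy => exact ⟨_, D.freeHom_serre _ ha i hi y, Submodule.zero_mem _⟩
  | serre_b i hi y hy => exact ⟨_, D.freeHom_serre _ hb i hi y, Submodule.zero_mem _⟩
  | comm_a x y hxy => exact ⟨_, D.freeHom_superComm _ _ ha ha x y, Submodule.zero_mem _⟩
  | comm_b x y hxy => exact ⟨_, D.freeHom_superComm _ _ hb hb x y, Submodule.zero_mem _⟩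
  | ab_ne x y hxy => exact ⟨_, D.freeHom_superComm _ _ ha hb x y, Submodule.zero_mem _⟩
  | ab_self x =>
    refine ⟨_, D.freeHom_superComm _ _ ha hb x x, ?_⟩
    rw [CharTwo.add_self_eq_zero]
    exact Submodule.smul_mem _ _ (Submodule.sub_mem _ (hq _) (hq _))

lemma freeDec_rel ⦃x y : D.Free⦄ (h : D.Rel x y) : D.freeDec x = D.freeDec y := by
  obtain ⟨c, ⟨u, hu⟩, ⟨v, hv⟩⟩ := D.rel_homogeneous h
  have h1 := D.coe_freeDec x
  have h2 := D.coe_freeDec y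
  simp only [AlgHom.toLinearMap_apply, DirectSum.lof_eq_of] at hu hv
  rw [← hu, DirectSum.coeAlgHom_of] at h1
  rw [← hv, DirectSum.coeAlgHom_of] at h2
  have h3 : D.mkU x = D.mkU y := RingQuot.mkAlgHom_rel (RatFunc ℚ) h
  rw [← hu, ← hv, Subtype.ext (h1.trans (h3.trans h2.symm))]

/-- The decomposition of an element of `U_q(𝔤)` into its homogeneous components. -/
def dec : D.U →ₐ[RatFunc ℚ] ⨁ c, D.parity c :=
  RingQuot.liftAlgHom (RatFunc ℚ) ⟨D.freeDec, D.freeDec_rel⟩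

lemma dec_mkU (x : D.Free) : D.dec (D.mkU x) = D.freeDec x := by
  simp [dec, mkU]

lemma dec_gen (g : D.Gen) :
    D.dec (D.gen g) = DirectSum.of (fun c => D.parity c) (D.genParity g)
      ⟨D.gen g, D.gen_mem g⟩ := by
  refine (D.dec_mkU _).trans ?_
  simp [freeDec]

lemma dec_word (w : List D.Gen) :
    D.dec (w.map D.gen).prod = DirectSum.of (fun c => D.parity c) (w.map D.genParity).sum
      ⟨(w.map D.gen).prod, Submodule.subset_span ⟨w, rfl, rfl⟩⟩ := by
  induction w with
  | nil => simp only [List.map_nil, List.prod_nil, map_one]; rfl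
  | cons g w ih =>
    simp only [List.map_cons, List.prod_cons, map_mul] at ih ⊢
    rw [ih, dec_gen, DirectSum.of_mul_of]
    rfl

/-- `U_q(𝔤)` is a superalgebra. -/
instance : GradedAlgebra D.parity :=
  GradedAlgebra.ofAlgHom D.parity D.dec
    (by
      refine RingQuot.ringQuot_ext' (RatFunc ℚ) _ _ ?_
      ext g
      change DirectSum.coeAlgHom D.parity (D.dec (D.gen g)) = D.gen g
      rw [dec_gen, DirectSum.coeAlgHom_of])
    (by
      rintro c ⟨x, hx⟩
      change D.dec x = DirectSum.lof (RatFunc ℚ) (ZMod 2) (fun c => D.parity c) c ⟨x, hx⟩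
      induction hx using Submodule.span_induction with
      | mem x h =>
        obtain ⟨w, rfl, rfl⟩ := h
        exact D.dec_word w
      | zero =>
        rw [map_zero]
        exact (map_zero _).symm
      | add x y hx hy h1 h2 =>
        rw [map_add, h1, h2, ← map_add]
        rfl
      | smul a x hx h =>
        rw [map_smul, h, ← map_smul]
        rfl)

end SuperBorcherdsCartanDatum

end

/-! Surjectivity is straightening: moving each `a` to the right of each `q^h` and `b`, and each
`q^h` to the right of each `b`, rewrites any word as a combination of ordered words of the same
parity (`a_mul_mem`, `parity_le_orderedSpan`).

Injectivity comes from a module on which the product `xyz` can be read off. On the space with basis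
the words in the letters `b`, tensored with the group algebra of the dual lattice and with `Z =
U^+`, let `b` prepend a letter, let `q^h` act by weights and translation, and let `a` act by the
recursion forced by the commutation of `a` with `b`. All relations mixing the three families then
hold. What remains is the relations inside the positive and the negative part.

The crux is that every Serre element or supercommutator of the `a` commutes with each `b` up to a
nonzero scalar, and symmetrically (`relator_mul`, `mul_relator`). For Serre elements this reduces to
identities for signed quantum binomials (`serreSum_mul_self`, `serreSum_mul_other`). Positive
relators vanish on the empty word because they vanish in `U^+`, hence they vanish on all words
(`relator_aOp`). Negative relators need not vanish, but the subspace they generate is stable under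
all operators (`aOp_mem`), so the quotient is a `U`-module.

That subspace dies when words are evaluated in `U^-`, so the quotient projects to `U^- ⊗ U^0 ⊗ U^+`.
Acting with `xyz` on the class of `1 ⊗ 1 ⊗ 1` and projecting gives `x ⊗ y ⊗ z`, which is a left
inverse of multiplication (`triSplit_triMul`). -/

noncomputable section

universe u v

/-! ### Signed quantum integers and alternating binomial sums. -/

section Scalars

variable {F : Type*} [Field F]

/-- The (unnormalized) quantum integer `(εQ)^n - Q^{-n}`. -/
def superBracket (ε Q : F) (n : ℤ) : F := (ε * Q) ^ n - Q ^ (-n)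

lemma superBracket_zero (ε Q : F) : superBracket ε Q 0 = 0 := by
  simp [superBracket]

/-- Summing the geometric series turns the sums produced by commuting powers into quantum integers,
with no division by the ratio minus one. -/
lemma geom_mul_eq_superBracket {ε Q : F} (hQ : Q ≠ 0) (n : ℕ) :
    (∑ r ∈ Finset.range n, (ε * Q ^ 2) ^ r) * (ε * Q ^ 2 - 1) = Q ^ n * superBracket ε Q n := by
  rw [geom_sum_mul, superBracket, zpow_natCast, zpow_neg, zpow_natCast, mul_sub,
    mul_inv_cancel₀ (pow_ne_zero n hQ), ← mul_pow]
  ring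

lemma geom_inv_mul_eq_superBracket {ε Q : F} (hε : ε * ε = 1) (hQ : Q ≠ 0) (n : ℕ) :
    (∑ r ∈ Finset.range n, (ε * (Q ^ 2)⁻¹) ^ r) * (ε * (Q ^ 2)⁻¹ - 1) =
      -((ε * Q⁻¹) ^ n * superBracket ε Q n) := by
  have h1 : (ε * Q⁻¹) ^ n * (ε * Q) ^ n = 1 := by
    rw [← mul_pow, show ε * Q⁻¹ * (ε * Q) = (ε * ε) * (Q⁻¹ * Q) by ring, hε,
      inv_mul_cancel₀ hQ, one_mul, one_pow]
  rw [geom_sum_mul, superBracket, zpow_natCast, zpow_neg, zpow_natCast, mul_sub, h1, mul_pow,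
    mul_pow, inv_pow, inv_pow]
  ring

/-- The two scalar identities behind the commutation of the Serre element with `b_i`. -/
lemma geom_mul_binom_eq {ε Q f f' : F} (hQ : Q ≠ 0) (hD : ε * Q ^ 2 - 1 ≠ 0)
    {N t : ℕ} (ht : t < N)
    (hf : f' * superBracket ε Q (t + 1 : ℕ) = f * superBracket ε Q (N - t : ℕ)) :
    f * (∑ r ∈ Finset.range (N - t), (ε * Q ^ 2) ^ r) * Q ^ (1 - N + 2 * t : ℤ) =
      f' * ∑ r ∈ Finset.range (t + 1), (ε * Q ^ 2) ^ r := by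
  apply mul_right_cancel₀ hD
  have h1 := geom_mul_eq_superBracket (ε := ε) hQ (N - t)
  have h2 := geom_mul_eq_superBracket (ε := ε) hQ (t + 1)
  have h3 : Q ^ (N - t) * Q ^ (1 - N + 2 * t : ℤ) = Q ^ (t + 1) := by
    rw [← zpow_natCast, ← zpow_add₀ hQ, ← zpow_natCast Q (t + 1)]
    congr 1
    push_cast [Nat.cast_sub ht.le]
    ring
  linear_combination (f * Q ^ (1 - N + 2 * t : ℤ)) * h1 - f' * h2 - Q ^ (t + 1) * hf +
    f * superBracket ε Q (N - t : ℕ) * h3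

/-- The counterpart for `K⁻¹`, with `Q` inverted. Unlike before, signs must now match: `ε ^ (N - t)
= ε ^ (t + 1)`, which is what `ε ^ N = ε` provides. -/
lemma geom_inv_mul_binom_eq {ε Q f f' : F} (hε : ε * ε = 1) (hQ : Q ≠ 0)
    (hD : ε * (Q ^ 2)⁻¹ - 1 ≠ 0) {N t : ℕ} (ht : t < N) (hN : ε ^ N = ε)
    (hf : f' * superBracket ε Q (t + 1 : ℕ) = f * superBracket ε Q (N - t : ℕ)) :
    f * (∑ r ∈ Finset.range (N - t), (ε * (Q ^ 2)⁻¹) ^ r) * Q ^ (-(1 - N + 2 * t) : ℤ) =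
      f' * ∑ r ∈ Finset.range (t + 1), (ε * (Q ^ 2)⁻¹) ^ r := by
  apply mul_right_cancel₀ hD
  have h1 := geom_inv_mul_eq_superBracket hε hQ (N - t)
  have h2 := geom_inv_mul_eq_superBracket hε hQ (t + 1)
  have h4 : ε ^ (N - t) = ε ^ (t + 1) := by
    have : ε ^ (N - t) * ε ^ t = ε ^ (t + 1) * ε ^ t := by
      rw [← pow_add, Nat.sub_add_cancel ht.le, hN, pow_succ, mul_right_comm, ← mul_pow, hε,
        one_pow, one_mul]
    exact mul_right_cancel₀ (pow_ne_zero _ (left_ne_zero_of_mul_eq_one hε)) this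
  have h3 : (ε * Q⁻¹) ^ (N - t) * Q ^ (-(1 - N + 2 * t) : ℤ) = (ε * Q⁻¹) ^ (t + 1) := by
    rw [mul_pow, mul_pow, h4, mul_assoc, inv_pow, inv_pow, ← zpow_natCast Q (N - t), ← zpow_neg,
      ← zpow_add₀ hQ, ← zpow_natCast Q (t + 1), ← zpow_neg]
    congr 2
    push_cast [Nat.cast_sub ht.le]
    ring
  linear_combination (f * Q ^ (-(1 - N + 2 * t) : ℤ)) * h1 - f' * h2 + (ε * Q⁻¹) ^ (t + 1) * hf -
    f * superBracket ε Q (N - t : ℕ) * h3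

lemma sign_choose_succ (ε : F) (m : ℕ) : ε ^ (m + 1).choose 2 = ε ^ m.choose 2 * ε ^ m := by
  rw [← pow_add, Nat.choose_succ_succ' m 1, Nat.choose_one_right, add_comm]

lemma sign_pow_sub {ε : F} (hε : ε * ε = 1) {N : ℕ} (hN : ε ^ N = ε) (m : ℕ) :
    ε ^ ((N : ℤ) - (m + 1 : ℕ)) = ε ^ m := by
  have h0 := left_ne_zero_of_mul_eq_one hε
  rw [zpow_sub₀ h0, zpow_natCast, zpow_natCast, hN, div_eq_iff (pow_ne_zero _ h0), pow_succ,
    ← mul_assoc, ← mul_pow, hε, one_pow, one_mul]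

/-- The vanishing of the alternating sum of quantum binomial coefficients. -/
lemma alternating_binom_sum_eq_zero {ε Q : F} (hε : ε * ε = 1) (hQ : Q ≠ 0) {N : ℕ}
    (hN : ε ^ N = ε) (hb : superBracket ε Q N ≠ 0) (f : ℕ → F) (hf0 : f 0 = 1)
    (hf : ∀ t : ℕ, f (t + 1) * superBracket ε Q (t + 1 : ℕ) = f t * superBracket ε Q (N - t)) :
    ∑ t ∈ Finset.range (N + 1), (-1) ^ t * ε ^ t.choose 2 * f t * (Q ^ (1 - N : ℤ)) ^ t = 0 := by
  have h0 := left_ne_zero_of_mul_eq_one hε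
  -- After multiplication by the bracket of `N` the partial sums have a closed form, proved by
  -- induction. It carries the bracket of `N - m`, which is zero at `m = N`.
  have key : ∀ m : ℕ, superBracket ε Q N *
      ∑ t ∈ Finset.range (m + 1), (-1) ^ t * ε ^ t.choose 2 * f t * (Q ^ (1 - N : ℤ)) ^ t =
        (-1) ^ m * ε ^ m.choose 2 * Q ^ (-(m * N) : ℤ) * (f m * superBracket ε Q (N - m)) := by
    intro m
    induction m with
    | zero => simp [hf0]
    | succ m ih =>
      rw [Finset.sum_range_succ, mul_add, ih, ← hf m, sign_choose_succ]
      have e1 : superBracket ε Q (m + 1 : ℕ) = ε ^ m * ε * Q ^ (m + 1 : ℤ) - Q ^ (-(m + 1) : ℤ) := by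
        rw [superBracket, mul_zpow, zpow_natCast, pow_succ]; push_cast; rfl
      have e2 : superBracket ε Q N = ε * Q ^ (N : ℤ) - Q ^ (-N : ℤ) := by
        rw [superBracket, mul_zpow, zpow_natCast ε, hN]
      have e3 : superBracket ε Q (N - (m + 1 : ℕ)) =
          ε ^ m * Q ^ (N - (m + 1) : ℤ) - Q ^ (-(N - (m + 1)) : ℤ) := by
        rw [superBracket, mul_zpow, sign_pow_sub hε hN]; push_cast; rfl
      have e4 : (Q ^ (1 - N : ℤ)) ^ (m + 1) = Q ^ ((1 - N) * (m + 1) : ℤ) := by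
        rw [zpow_mul]; exact_mod_cast rfl
      have e5 : ε ^ m * ε ^ m = 1 := by rw [← mul_pow, hε, one_pow]
      rw [e1, e2, e3, e4]
      have a1 : Q ^ (-(m * N) : ℤ) * Q ^ (m + 1 : ℤ) = Q ^ (N : ℤ) * Q ^ ((1 - N) * (m + 1) : ℤ) := by
        rw [← zpow_add₀ hQ, ← zpow_add₀ hQ]; ring_nf
      have a2 : Q ^ (-(m * N) : ℤ) * Q ^ (-(m + 1) : ℤ) =
          Q ^ (-((m + 1 : ℕ) * N) : ℤ) * Q ^ (N - (m + 1) : ℤ) := by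
        rw [← zpow_add₀ hQ, ← zpow_add₀ hQ]; push_cast; ring_nf
      have a3 : Q ^ (-N : ℤ) * Q ^ ((1 - N) * (m + 1) : ℤ) =
          Q ^ (-((m + 1 : ℕ) * N) : ℤ) * Q ^ (-(N - (m + 1)) : ℤ) := by
        rw [← zpow_add₀ hQ, ← zpow_add₀ hQ]; push_cast; ring_nf
      rw [pow_succ (-1 : F)]
      linear_combination (f (m + 1) * (-1) ^ m * ε ^ m.choose 2) *
        ((ε ^ m * ε) * a1 - a2 + ε ^ m * a3 -
          Q ^ (-((m + 1 : ℕ) * N) : ℤ) * Q ^ (N - (m + 1) : ℤ) * e5 * (-1) )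
  have h := key N
  rw [sub_self, superBracket_zero, mul_zero, mul_zero] at h
  exact (mul_eq_zero.1 h).resolve_left hb

/-- The same argument for the opposite power of `Q`; the closed form of the partial sums picks up an
extra sign `ε ^ m`. -/
lemma alternating_binom_sum_eq_zero' {ε Q : F} (hε : ε * ε = 1) (hQ : Q ≠ 0) {N : ℕ}
    (hN : ε ^ N = ε) (hb : superBracket ε Q N ≠ 0) (f : ℕ → F) (hf0 : f 0 = 1)
    (hf : ∀ t : ℕ, f (t + 1) * superBracket ε Q (t + 1 : ℕ) = f t * superBracket ε Q (N - t)) :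
    ∑ t ∈ Finset.range (N + 1), (-1) ^ t * ε ^ t.choose 2 * f t * (Q ^ (N - 1 : ℤ)) ^ t = 0 := by
  have key : ∀ m : ℕ, superBracket ε Q N *
      ∑ t ∈ Finset.range (m + 1), (-1) ^ t * ε ^ t.choose 2 * f t * (Q ^ (N - 1 : ℤ)) ^ t =
        (-1) ^ m * (ε ^ m.choose 2 * ε ^ m) * Q ^ (m * N : ℤ) *
          (f m * superBracket ε Q (N - m)) := by
    intro m
    induction m with
    | zero => simp [hf0]
    | succ m ih =>
      rw [Finset.sum_range_succ, mul_add, ih, ← hf m, sign_choose_succ]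
      have e1 : superBracket ε Q (m + 1 : ℕ) = ε ^ m * ε * Q ^ (m + 1 : ℤ) - Q ^ (-(m + 1) : ℤ) := by
        rw [superBracket, mul_zpow, zpow_natCast, pow_succ]; push_cast; rfl
      have e2 : superBracket ε Q N = ε * Q ^ (N : ℤ) - Q ^ (-N : ℤ) := by
        rw [superBracket, mul_zpow, zpow_natCast ε, hN]
      have e3 : superBracket ε Q (N - (m + 1 : ℕ)) =
          ε ^ m * Q ^ (N - (m + 1) : ℤ) - Q ^ (-(N - (m + 1)) : ℤ) := by
        rw [superBracket, mul_zpow, sign_pow_sub hε hN]; push_cast; rfl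
      have e4 : (Q ^ (N - 1 : ℤ)) ^ (m + 1) = Q ^ ((N - 1) * (m + 1) : ℤ) := by
        rw [zpow_mul]; exact_mod_cast rfl
      have e5 : ε ^ m * ε ^ m = 1 := by rw [← mul_pow, hε, one_pow]
      rw [e1, e2, e3, e4]
      have a1 : Q ^ (m * N : ℤ) * Q ^ (m + 1 : ℤ) =
          Q ^ ((m + 1 : ℕ) * N : ℤ) * Q ^ (-(N - (m + 1)) : ℤ) := by
        rw [← zpow_add₀ hQ, ← zpow_add₀ hQ]; push_cast; ring_nf
      have a2 : Q ^ (m * N : ℤ) * Q ^ (-(m + 1) : ℤ) =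
          Q ^ (-N : ℤ) * Q ^ ((N - 1) * (m + 1) : ℤ) := by
        rw [← zpow_add₀ hQ, ← zpow_add₀ hQ]; ring_nf
      have a3 : Q ^ (N : ℤ) * Q ^ ((N - 1) * (m + 1) : ℤ) =
          Q ^ ((m + 1 : ℕ) * N : ℤ) * Q ^ (N - (m + 1) : ℤ) := by
        rw [← zpow_add₀ hQ, ← zpow_add₀ hQ]; push_cast; ring_nf
      rw [pow_succ (-1 : F), pow_succ ε]
      linear_combination (f (m + 1) * (-1) ^ m * ε ^ m.choose 2 * ε ^ m) *
        ((ε ^ m * ε) * a1 - a2 - ε * a3 -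
          ε * Q ^ ((m + 1 : ℕ) * N : ℤ) * Q ^ (N - (m + 1) : ℤ) * e5 * (-1))
  have h := key N
  rw [sub_self, superBracket_zero, mul_zero, mul_zero] at h
  exact (mul_eq_zero.1 h).resolve_left hb

end Scalars

/-! ### Skew-commutation of powers and of Serre-type sums in an algebra. -/

section Commutation

variable {F R : Type*} [Field F] [Ring R] [Algebra F R]

lemma pow_mul_of_skew {x y : R} {c : F} (h : x * y = c • (y * x)) (n : ℕ) :
    x * y ^ n = c ^ n • (y ^ n * x) := by
  induction n with
  | zero => simp
  | succ n ih =>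
    rw [pow_succ, ← mul_assoc, ih, smul_mul_assoc, mul_assoc, h, mul_smul_comm, smul_smul,
      ← mul_assoc, ← pow_succ c]

lemma pow_mul_of_skew' {x y : R} {c : F} (h : y * x = c • (x * y)) (n : ℕ) :
    y ^ n * x = c ^ n • (x * y ^ n) := by
  induction n with
  | zero => simp
  | succ n ih =>
    rw [pow_succ, mul_assoc, h, mul_smul_comm, ← mul_assoc, ih, smul_mul_assoc, smul_smul,
      mul_assoc, ← pow_succ' c]

/-- Each of the `n` exchanges of `b` with an `a` leaves a `K - K'`; dragging it to the right through
the remaining factors `a` makes the contributions a geometric sum. -/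
lemma pow_mul_skew_add {a b K K' : R} {ε c c' : F} (hab : a * b = ε • (b * a) + (K - K'))
    (hK : K * a = c • (a * K)) (hK' : K' * a = c' • (a * K')) (n : ℕ) :
    a ^ n * b = ε ^ n • (b * a ^ n) +
      ((∑ r ∈ Finset.range n, (ε * c) ^ r) • (a ^ (n - 1) * K) -
        (∑ r ∈ Finset.range n, (ε * c') ^ r) • (a ^ (n - 1) * K')) := by
  induction n with
  | zero => simp
  | succ n ih =>
    have h1 : a ^ (n + 1) * b = a * (a ^ n * b) := by rw [pow_succ', mul_assoc]
    have h2 : a * b * a ^ n = ε • (b * a ^ (n + 1)) + (c ^ n • (a ^ n * K) - c' ^ n • (a ^ n * K')) := by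
      rw [hab, add_mul, sub_mul, pow_mul_of_skew hK, pow_mul_of_skew hK', smul_mul_assoc,
        mul_assoc, ← pow_succ']
    rcases Nat.eq_zero_or_pos n with rfl | hn
    · simp [hab]
    · have h3 : ∀ z : R, a * (a ^ (n - 1) * z) = a ^ n * z := fun z => by
        rw [← mul_assoc, ← pow_succ', Nat.sub_add_cancel hn]
      rw [h1, ih, mul_add, mul_sub, mul_smul_comm, mul_smul_comm, mul_smul_comm, h3, h3,
        ← mul_assoc, h2, Nat.add_sub_cancel, Finset.sum_range_succ, Finset.sum_range_succ,
        mul_pow, mul_pow, pow_succ ε]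
      module

/-- The element `∑ₜ cₜ a^{N-t} y a^t`. -/
def serreSum (co : ℕ → F) (N : ℕ) (a y : R) : R :=
  ∑ t ∈ Finset.range (N + 1), co t • (a ^ (N - t) * y * a ^ t)

/-- Only the middle factor `y` fails to skew-commute with `b`. Term `t` therefore leaves multiples
of `a ^ N * K` and `a ^ N * K'`, and the hypotheses `h`, `h'` say that the total coefficients
vanish. -/
lemma serreSum_mul_other {a y b K K' : R} {s s' c c' : F} {co : ℕ → F} {N : ℕ}
    (hab : a * b = s • (b * a)) (hyb : y * b = s' • (b * y) + (K - K'))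
    (hK : K * a = c • (a * K)) (hK' : K' * a = c' • (a * K'))
    (h : ∑ t ∈ Finset.range (N + 1), co t * (s * c) ^ t = 0)
    (h' : ∑ t ∈ Finset.range (N + 1), co t * (s * c') ^ t = 0) :
    serreSum co N a y * b = (s ^ N * s') • (b * serreSum co N a y) := by
  have key : ∀ t ∈ Finset.range (N + 1), co t • (a ^ (N - t) * y * a ^ t) * b =
      (s ^ N * s') • (b * (co t • (a ^ (N - t) * y * a ^ t))) +
        ((co t * (s * c) ^ t) • (a ^ N * K) - (co t * (s * c') ^ t) • (a ^ N * K')) := by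
    intro t ht
    have ht' : t ≤ N := Nat.lt_succ_iff.1 (Finset.mem_range.1 ht)
    have e : ∀ z : R, a ^ (N - t) * (a ^ t * z) = a ^ N * z := fun z => by
      rw [← mul_assoc, ← pow_add, Nat.sub_add_cancel ht']
    have e1 : a ^ (N - t) * (b * (y * a ^ t)) = s ^ (N - t) • (b * (a ^ (N - t) * (y * a ^ t))) := by
      rw [← mul_assoc, pow_mul_of_skew' hab, smul_mul_assoc, mul_assoc]
    have e2 : s ^ t * s ^ (N - t) = s ^ N := by rw [← pow_add, Nat.add_sub_cancel' ht']
    rw [smul_mul_assoc, mul_assoc, mul_assoc, pow_mul_of_skew' hab, mul_smul_comm, mul_smul_comm,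
      ← mul_assoc y, hyb, add_mul, sub_mul, pow_mul_of_skew hK, pow_mul_of_skew hK', mul_add,
      mul_sub, mul_smul_comm, mul_smul_comm, smul_mul_assoc, mul_smul_comm, e, e, mul_assoc b,
      e1, mul_smul_comm, ← e2, mul_pow, mul_pow, mul_assoc (a ^ (N - t))]
    module
  rw [serreSum, Finset.sum_mul, Finset.sum_congr rfl key, Finset.sum_add_distrib,
    Finset.sum_sub_distrib, ← Finset.sum_smul, ← Finset.sum_smul, h, h', zero_smul, zero_smul,
    sub_zero, add_zero, Finset.mul_sum, Finset.smul_sum]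

/-- Here the powers of `a` fail to skew-commute with `b`. The remainder `a ^ (N-1-t) * y * a ^ t *
K` arises twice, from the left power in term `t` and from the right power in term `t + 1`; `h` and
`h'` make the two cancel. -/
lemma serreSum_mul_self {a y b K K' : R} {ε s c c' d d' : F} {co : ℕ → F} {N : ℕ}
    (hab : a * b = ε • (b * a) + (K - K')) (hyb : y * b = s • (b * y))
    (hK : K * a = c • (a * K)) (hK' : K' * a = c' • (a * K'))
    (hKy : K * y = d • (y * K)) (hKy' : K' * y = d' • (y * K'))
    (h : ∀ t < N, co t * ε ^ t * s * (∑ r ∈ Finset.range (N - t), (ε * c) ^ r) * (d * c ^ t) +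
      co (t + 1) * ∑ r ∈ Finset.range (t + 1), (ε * c) ^ r = 0)
    (h' : ∀ t < N, co t * ε ^ t * s * (∑ r ∈ Finset.range (N - t), (ε * c') ^ r) * (d' * c' ^ t) +
      co (t + 1) * ∑ r ∈ Finset.range (t + 1), (ε * c') ^ r = 0) :
    serreSum co N a y * b = (ε ^ N * s) • (b * serreSum co N a y) := by
  set g : ℕ → F := fun n => ∑ r ∈ Finset.range n, (ε * c) ^ r with hg
  set g' : ℕ → F := fun n => ∑ r ∈ Finset.range n, (ε * c') ^ r with hg'
  set X : ℕ → R := fun t => a ^ (N - t - 1) * y * a ^ t with hX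
  set Y : ℕ → R := fun t => a ^ (N - t) * y * a ^ (t - 1) with hY
  have key : ∀ t ∈ Finset.range (N + 1), co t • (a ^ (N - t) * y * a ^ t) * b =
      (ε ^ N * s) • (b * (co t • (a ^ (N - t) * y * a ^ t))) +
        (((co t * ε ^ t * s * g (N - t) * (d * c ^ t)) • (X t * K) -
          (co t * ε ^ t * s * g' (N - t) * (d' * c' ^ t)) • (X t * K')) +
        ((co t * g t) • (Y t * K) - (co t * g' t) • (Y t * K'))) := by
    intro t ht
    have ht' : t ≤ N := Nat.lt_succ_iff.1 (Finset.mem_range.1 ht)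
    have e2 : ε ^ t * ε ^ (N - t) = ε ^ N := by rw [← pow_add, Nat.add_sub_cancel' ht']
    have hKya : K * (y * a ^ t) = (d * c ^ t) • (y * (a ^ t * K)) := by
      rw [← mul_assoc, hKy, smul_mul_assoc, mul_assoc, pow_mul_of_skew hK, mul_smul_comm, smul_smul]
    have hKya' : K' * (y * a ^ t) = (d' * c' ^ t) • (y * (a ^ t * K')) := by
      rw [← mul_assoc, hKy', smul_mul_assoc, mul_assoc, pow_mul_of_skew hK', mul_smul_comm,
        smul_smul]
    have e1 : a ^ (N - t) * (b * (y * a ^ t)) = ε ^ (N - t) • (b * (a ^ (N - t) * (y * a ^ t))) +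
        ((g (N - t) * (d * c ^ t)) • (X t * K) - (g' (N - t) * (d' * c' ^ t)) • (X t * K')) := by
      rw [← mul_assoc, pow_mul_skew_add hab hK hK', add_mul, sub_mul, smul_mul_assoc,
        smul_mul_assoc, smul_mul_assoc, mul_assoc, mul_assoc, mul_assoc, hKya, hKya']
      simp only [hX, hg, hg', mul_smul_comm, smul_smul, mul_assoc]
    have e3 : y * (b * a ^ t) = s • (b * (y * a ^ t)) := by
      rw [← mul_assoc, hyb, smul_mul_assoc, mul_assoc]
    have e4 : ∀ z : R, a ^ (N - t) * (y * (a ^ (t - 1) * z)) = Y t * z := fun z => by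
      simp only [hY, mul_assoc]
    rw [smul_mul_assoc, mul_assoc, mul_assoc, pow_mul_skew_add hab hK hK', mul_add, mul_sub,
      mul_smul_comm, mul_smul_comm, mul_smul_comm, e3, mul_add, mul_sub, mul_smul_comm,
      mul_smul_comm, mul_smul_comm, mul_smul_comm, e4, e4, e1, ← e2, mul_smul_comm,
      mul_assoc (a ^ (N - t))]
    module
  -- Shifting the index of the right remainders aligns them with the left ones. The unmatched
  -- boundary terms, where the subtraction in the exponent truncates, carry an empty geometric sum.
  have hXY : ∀ t, Y (t + 1) = X t := fun t => by
    simp only [hX, hY, Nat.sub_sub, Nat.add_sub_cancel]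
  have g0 : g 0 = 0 := by simp [hg]
  have g0' : g' 0 = 0 := by simp [hg']
  rw [serreSum, Finset.sum_mul, Finset.sum_congr rfl key, Finset.sum_add_distrib, Finset.mul_sum,
    Finset.smul_sum, add_eq_left, Finset.sum_add_distrib, Finset.sum_range_succ,
    Finset.sum_range_succ' _ N, Nat.sub_self, g0, g0']
  simp only [mul_zero, zero_mul, zero_smul, sub_zero, add_zero]
  rw [← Finset.sum_add_distrib]
  refine Finset.sum_eq_zero fun t ht => ?_
  have ht' := Finset.mem_range.1 ht
  rw [hXY, sub_add_sub_comm, ← add_smul, ← add_smul, h t ht', h' t ht', zero_smul, zero_smul,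
    sub_zero]

/-- Every monomial contains `N` factors `a` and one `y`, so all of them pick up the same scalar. -/
lemma serreSum_intertwine {M M' : Type*} [AddCommGroup M] [Module F M] [AddCommGroup M']
    [Module F M'] {f : M →ₗ[F] M'} {a y : Module.End F M} {a' y' : Module.End F M'} {c d : F}
    (ha : ∀ m, f (a m) = c • a' (f m)) (hy : ∀ m, f (y m) = d • y' (f m))
    (co : ℕ → F) (N : ℕ) (m : M) :
    f (serreSum co N a y m) = (c ^ N * d) • serreSum co N a' y' (f m) := by
  have hp : ∀ n m, f ((a ^ n) m) = c ^ n • (a' ^ n) (f m) := by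
    intro n
    induction n with
    | zero => simp
    | succ n ih =>
      intro m
      rw [pow_succ, Module.End.mul_apply, ih, ha, map_smul, smul_smul, ← Module.End.mul_apply,
        ← pow_succ, ← pow_succ]
  simp only [serreSum, LinearMap.sum_apply, map_sum, LinearMap.smul_apply, map_smul,
    Module.End.mul_apply, Finset.smul_sum]
  refine Finset.sum_congr rfl fun t ht => ?_
  have ht' : t ≤ N := Nat.lt_succ_iff.1 (Finset.mem_range.1 ht)
  have e2 : c ^ (N - t) * c ^ t = c ^ N := by rw [← pow_add, Nat.sub_add_cancel ht']
  rw [hp, hy, hp, map_smul, map_smul, map_smul, ← e2]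
  module

lemma map_serreSum {R' : Type*} [Ring R'] [Algebra F R'] (φ : R →ₐ[F] R') (co : ℕ → F) (N : ℕ)
    (a y : R) : φ (serreSum co N a y) = serreSum co N (φ a) (φ y) := by
  simp [serreSum]

end Commutation

/-! ### Signs, quantum binomials and Serre exponents of the datum. -/

namespace SuperBorcherdsCartanDatum

variable {I : Type u} {P : Type v} [AddCommGroup P] [Module.Free ℤ P]
  (D : SuperBorcherdsCartanDatum I P)

/-- The sign `(-1)^{p(x)p(y)}`. -/
def sgn (x y : D.IInf) : RatFunc ℚ := (-1) ^ (D.pInf x * D.pInf y)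

lemma sgn_comm (x y : D.IInf) : D.sgn x y = D.sgn y x := by rw [sgn, sgn, mul_comm]

lemma sgn_mul_self (x y : D.IInf) : D.sgn x y * D.sgn x y = 1 := by
  rw [sgn, ← mul_pow]; simp

/-- The sign `(-1)^{p(i)}`. -/
def eps (i : I) : RatFunc ℚ := (-1) ^ D.pn i

lemma eps_mul_self (i : I) : D.eps i * D.eps i = 1 := by
  rw [eps, ← mul_pow]; simp

lemma pn_mul_self (i : I) : D.pn i * D.pn i = D.pn i := by
  have h : D.pn i < 2 := ZMod.val_lt _
  interval_cases D.pn i <;> rfl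

lemma pInf_reIdx (i : I) (hi : D.A i i = 2) : D.pInf (D.reIdx i hi) = D.pn i := by
  have h : D.pn i < 2 := ZMod.val_lt _
  simp only [pInf, reIdx, one_mul]
  exact Nat.mod_eq_of_lt h

lemma sgn_reIdx_self (i : I) (hi : D.A i i = 2) :
    D.sgn (D.reIdx i hi) (D.reIdx i hi) = D.eps i := by
  rw [sgn, pInf_reIdx, pn_mul_self, eps]

lemma qi_ne_zero (i : I) : D.qi i ≠ 0 := pow_ne_zero _ RatFunc.X_ne_zero

lemma ratFunc_X_pow_ne_one {n : ℕ} (hn : n ≠ 0) : (RatFunc.X : RatFunc ℚ) ^ n ≠ 1 := by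
  intro h
  rw [← RatFunc.algebraMap_X, ← map_pow, ← map_one (algebraMap (Polynomial ℚ) (RatFunc ℚ))] at h
  have h1 := congrArg Polynomial.natDegree (RatFunc.algebraMap_injective ℚ h)
  rw [Polynomial.natDegree_X_pow, Polynomial.natDegree_one] at h1
  exact hn h1

/-- Vanishing would give `ε ^ n * Q ^ (2n) = 1`; squaring removes the sign and makes the
indeterminate a root of unity. -/
lemma superBracket_qi_ne_zero (i : I) {n : ℕ} (hn : n ≠ 0) :
    superBracket (D.eps i) (D.qi i) n ≠ 0 := by
  intro h
  have hQ := D.qi_ne_zero i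
  rw [superBracket, sub_eq_zero, zpow_neg, zpow_natCast, zpow_natCast,
    ← mul_eq_one_iff_eq_inv₀ (pow_ne_zero _ hQ), mul_pow] at h
  have h2 : (D.eps i ^ n * D.eps i ^ n) * (D.qi i ^ n) ^ 4 = 1 := by
    linear_combination (D.eps i ^ n * (D.qi i ^ n) ^ 2 + 1) * h
  rw [← mul_pow, eps_mul_self, one_pow, one_mul, qi, ← pow_mul, ← pow_mul] at h2
  exact ratFunc_X_pow_ne_one
    (mul_ne_zero (D.d_pos i).ne' (mul_ne_zero hn four_ne_zero)) h2

lemma qBinom_zero (i : I) (a : ℤ) : D.qBinom i a 0 = 1 := by simp [qBinom]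

/-- This recursion and the value at `t = 0` are all that the argument needs to know about the
binomials. -/
lemma qBinom_succ (i : I) (a : ℤ) (t : ℕ) :
    D.qBinom i a (t + 1) * superBracket (D.eps i) (D.qi i) (t + 1 : ℕ) =
      D.qBinom i a t * superBracket (D.eps i) (D.qi i) (a - t) := by
  have h := D.superBracket_qi_ne_zero i (Nat.succ_ne_zero t)
  have h1 : ∀ t : ℕ, ∏ s ∈ Finset.Icc 1 t,
      (((-1) ^ D.pn i * D.qi i) ^ (s : ℤ) - D.qi i ^ (-(s : ℤ))) ≠ 0 := fun t =>
    Finset.prod_ne_zero_iff.2 fun s hs =>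
      D.superBracket_qi_ne_zero i (Nat.one_le_iff_ne_zero.1 (Finset.mem_Icc.1 hs).1)
  have h2 : superBracket (D.eps i) (D.qi i) (a - t) =
      ((-1) ^ D.pn i * D.qi i) ^ (a - (t : ℤ)) - D.qi i ^ ((t : ℤ) - a) := by
    rw [superBracket, neg_sub, eps]
  have h3 : superBracket (D.eps i) (D.qi i) (t + 1 : ℕ) =
      ((-1) ^ D.pn i * D.qi i) ^ ((t + 1 : ℕ) : ℤ) - D.qi i ^ (-((t + 1 : ℕ) : ℤ)) := rfl
  rw [h3] at h ⊢
  rw [h2, qBinom, qBinom, Finset.prod_range_succ, Finset.prod_Icc_succ_top (by omega),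
    div_mul_eq_mul_div, div_mul_eq_mul_div, div_eq_div_iff (mul_ne_zero (h1 t) h) (h1 t)]
  ring

/-- The exponent `1 - k a_{ij}` of the Serre relation. -/
def serreExp (i : I) (y : D.IInf) : ℕ := (1 - (y.1.2 : ℤ) * D.A i y.1.1).toNat

/-- The coefficients of the Serre relation. -/
def serreCoeff (i : I) (y : D.IInf) (t : ℕ) : RatFunc ℚ :=
  (-1) ^ t * (-1) ^ (D.pn i * (t * D.pInf y + t.choose 2)) *
    D.qBinom i (1 - (y.1.2 : ℤ) * D.A i y.1.1) t

lemma serreCoeff_eq (i : I) (hi : D.A i i = 2) (y : D.IInf) (t : ℕ) :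
    D.serreCoeff i y t = (-1) ^ t * D.sgn (D.reIdx i hi) y ^ t * D.eps i ^ t.choose 2 *
      D.qBinom i (1 - (y.1.2 : ℤ) * D.A i y.1.1) t := by
  rw [serreCoeff, sgn, eps, pInf_reIdx, ← pow_mul, ← pow_mul, mul_add, pow_add,
    show D.pn i * (t * D.pInf y) = D.pn i * D.pInf y * t by ring]
  ring

/-- A real index occurs in `I^∞` only with `l = 1`. -/
lemma fst_ne_of_reIdx_ne {i : I} {hi : D.A i i = 2} {y : D.IInf} (hy : D.reIdx i hi ≠ y) :
    i ≠ y.1.1 := by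
  rintro rfl
  apply hy
  rcases y.2 with h | h
  · exact Subtype.ext (Prod.ext rfl h.2.symm)
  · exact absurd h.1 (by rw [hi]; decide)

lemma serreExp_cast {i : I} {hi : D.A i i = 2} {y : D.IInf} (hy : D.reIdx i hi ≠ y) :
    (D.serreExp i y : ℤ) = 1 - (y.1.2 : ℤ) * D.A i y.1.1 := by
  refine Int.toNat_of_nonneg ?_
  have h := D.A_offDiag i y.1.1 (D.fst_ne_of_reIdx_ne hy)
  nlinarith [Int.natCast_nonneg y.1.2]

lemma serreExp_ne_zero {i : I} {hi : D.A i i = 2} {y : D.IInf} (hy : D.reIdx i hi ≠ y) :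
    D.serreExp i y ≠ 0 := by
  have h1 := D.serreExp_cast hy
  have h := D.A_offDiag i y.1.1 (D.fst_ne_of_reIdx_ne hy)
  have : (0 : ℤ) < D.serreExp i y := by nlinarith [Int.natCast_nonneg y.1.2]
  omega

/-- If `i` is odd then `a_{ij}` is even, so the exponent `1 - k a_{ij}` is odd; if `i` is even the
sign is `1`. -/
lemma eps_pow_serreExp {i : I} {hi : D.A i i = 2} {y : D.IInf} (hy : D.reIdx i hi ≠ y) :
    D.eps i ^ D.serreExp i y = D.eps i := by
  have h2 : D.pn i < 2 := ZMod.val_lt _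
  rcases Nat.lt_succ_iff_lt_or_eq.1 h2 with h0 | h1
  · have : D.pn i = 0 := by omega
    simp [eps, this]
  · have hp : D.p i = 1 := by
      apply ZMod.val_injective 2
      rw [show (D.p i).val = D.pn i from rfl, h1]; rfl
    obtain ⟨m, hm⟩ := D.even_of_odd i hp y.1.1
    have hodd : Odd (D.serreExp i y) := by
      have := D.serreExp_cast hy
      rw [← Int.odd_coe_nat, this, hm]
      exact ⟨-(y.1.2 * m), by ring⟩
    rw [eps, h1, pow_one, hodd.neg_one_pow]

/-! ### Relators and their skew-commutation with the opposite part. -/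

section

variable {R : Type*} [Ring R] [Algebra (RatFunc ℚ) R]

/-- The Serre element attached to a family of elements of an algebra. -/
def serreIn (g : D.IInf → R) (i : I) (hi : D.A i i = 2) (y : D.IInf) : R :=
  serreSum (D.serreCoeff i y) (D.serreExp i y) (g (D.reIdx i hi)) (g y)

/-- The supercommutator of two members of a family of elements of an algebra. -/
def commIn (g : D.IInf → R) (x y : D.IInf) : R := g x * g y - D.sgn x y • (g y * g x)

lemma map_serre (φ : D.Free →ₐ[RatFunc ℚ] R) (g : D.IInf → D.Free) (i : I) (hi : D.A i i = 2)
    (y : D.IInf) : φ (D.serre g i hi y) = D.serreIn (fun x => φ (g x)) i hi y :=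
  map_serreSum φ _ _ _ _

lemma map_superComm (φ : D.Free →ₐ[RatFunc ℚ] R) (g g' : D.IInf → D.Free) (x y : D.IInf) :
    φ (D.superComm g g' x y) = φ (g x) * φ (g' y) - D.sgn x y • (φ (g' y) * φ (g x)) := by
  simp [superComm, sgn]

lemma map_serreIn {R' : Type*} [Ring R'] [Algebra (RatFunc ℚ) R'] (φ : R →ₐ[RatFunc ℚ] R')
    (g : D.IInf → R) (i : I) (hi : D.A i i = 2) (y : D.IInf) :
    φ (D.serreIn g i hi y) = D.serreIn (fun x => φ (g x)) i hi y :=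
  map_serreSum φ _ _ _ _

lemma map_commIn {R' : Type*} [Ring R'] [Algebra (RatFunc ℚ) R'] (φ : R →ₐ[RatFunc ℚ] R')
    (g : D.IInf → R) (x y : D.IInf) :
    φ (D.commIn g x y) = D.commIn (fun x => φ (g x)) x y := by
  simp [commIn]

/-- Indices of the relators within the positive or the negative part: Serre relations and
supercommutators of orthogonal indices. -/
inductive RelIdx : Type u
  | serre (i : I) (hi : D.A i i = 2) (y : D.IInf) (hy : D.reIdx i hi ≠ y)
  | comm (x y : D.IInf) (hxy : D.A x.1.1 y.1.1 = 0)

/-- The relator with a given index among the members of a family `g`. -/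
def relator (g : D.IInf → R) : D.RelIdx → R
  | .serre i hi y _ => D.serreIn g i hi y
  | .comm x y _ => D.commIn g x y

lemma map_relator {R' : Type*} [Ring R'] [Algebra (RatFunc ℚ) R'] (φ : R →ₐ[RatFunc ℚ] R')
    (g : D.IInf → R) (r : D.RelIdx) :
    φ (D.relator g r) = D.relator (fun x => φ (g x)) r := by
  cases r with
  | serre i hi y hy => exact D.map_serreIn φ g i hi y
  | comm x y hxy => exact D.map_commIn φ g x y

/-- A linear map intertwining two families up to nonzero scalars intertwines their relators. -/
lemma exists_relator_intertwine {M M' : Type*} [AddCommGroup M] [Module (RatFunc ℚ) M]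
    [AddCommGroup M'] [Module (RatFunc ℚ) M'] {f : M →ₗ[RatFunc ℚ] M'}
    {g : D.IInf → Module.End (RatFunc ℚ) M} {g' : D.IInf → Module.End (RatFunc ℚ) M'}
    {χ : D.IInf → RatFunc ℚ} (hχ : ∀ x, χ x ≠ 0) (hg : ∀ x m, f (g x m) = χ x • g' x (f m))
    (r : D.RelIdx) :
    ∃ c : RatFunc ℚ, c ≠ 0 ∧ ∀ m, f (D.relator g r m) = c • D.relator g' r (f m) := by
  cases r with
  | serre i hi y hy =>
    exact ⟨_, mul_ne_zero (pow_ne_zero _ (hχ _)) (hχ _),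
      serreSum_intertwine (hg _) (hg _) _ _⟩
  | comm x y hxy =>
    refine ⟨χ x * χ y, mul_ne_zero (hχ _) (hχ _), fun m => ?_⟩
    simp only [relator, commIn, LinearMap.sub_apply, Module.End.mul_apply, LinearMap.smul_apply,
      map_sub, map_smul, hg, smul_sub, smul_smul]
    rw [mul_comm (D.sgn x y), mul_comm (χ y)]

/-- The element `l d_i h_i` of the dual weight lattice, so that `K_i^l = q^{l d_i h_i}`. -/
def kExp (x : D.IInf) : Module.Dual ℤ P := (x.1.2 * D.d x.1.1) • D.coroot x.1.1

/-- The exponent `l ⟨h, α_i⟩`. -/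
def wt (x : D.IInf) (h : Module.Dual ℤ P) : ℤ := (x.1.2 : ℤ) * h (D.root x.1.1)

lemma wt_kExp (x y : D.IInf) :
    D.wt y (D.kExp x) = y.1.2 * x.1.2 * (D.d x.1.1 * D.A x.1.1 y.1.1) := by
  simp only [wt, kExp, LinearMap.smul_apply, D.pairing]
  simp only [nsmul_eq_mul, Nat.cast_mul]
  ring

lemma wt_kExp_symm (x y : D.IInf) : D.wt y (D.kExp x) = D.wt x (D.kExp y) := by
  rw [wt_kExp, wt_kExp, D.symm]; ring

lemma wt_neg (x : D.IInf) (h : Module.Dual ℤ P) : D.wt x (-h) = -D.wt x h := by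
  simp [wt]

lemma wt_zero (x : D.IInf) : D.wt x 0 = 0 := by simp [wt]

lemma wt_add (x : D.IInf) (h h' : Module.Dual ℤ P) : D.wt x (h + h') = D.wt x h + D.wt x h' := by
  simp [wt, mul_add]

variable (R) in
/-- Families of elements of an algebra that satisfy the defining relations of `U_q(𝔤)` other than
those within the positive or the negative part, with arbitrary scalars in the commutators of
`a_{il}` and `b_{il}`. -/
structure TriRep where
  a : D.IInf → R
  b : D.IInf → R
  k : Module.Dual ℤ P → R
  κ : D.IInf → RatFunc ℚ
  k_a : ∀ h x, k h * a x = (RatFunc.X ^ D.wt x h : RatFunc ℚ) • (a x * k h)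
  k_b : ∀ h x, k h * b x = (RatFunc.X ^ (-D.wt x h) : RatFunc ℚ) • (b x * k h)
  ab_ne : ∀ x y, x ≠ y → a x * b y = D.sgn x y • (b y * a x)
  ab_self : ∀ x, a x * b x =
    D.sgn x x • (b x * a x) + (κ x • k (D.kExp x) - κ x • k (-D.kExp x))

namespace TriRep

variable {D} (T : D.TriRep R)

/-- Exchange of the positive and the negative part. -/
def swap : D.TriRep R where
  a := T.b
  b := T.a
  k h := T.k (-h)
  -- Solving the relation for `b * a` multiplies the scalar by the sign, which is its own inverse;
  -- replacing `h` by `-h` absorbs the minus sign.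
  κ x := D.sgn x x * T.κ x
  k_a h x := by rw [T.k_b, wt_neg, neg_neg]
  k_b h x := by rw [T.k_a, wt_neg]
  ab_ne x y hxy := by
    rw [T.ab_ne y x hxy.symm, D.sgn_comm y x, smul_smul, sgn_mul_self, one_smul]
  ab_self x := by
    rw [T.ab_self x, smul_add, smul_smul, sgn_mul_self, one_smul, neg_neg, mul_smul, mul_smul,
      smul_sub, add_assoc, sub_add_sub_cancel, sub_self, add_zero]

lemma k_kExp_mul (x y : D.IInf) (c : RatFunc ℚ) :
    c • T.k (D.kExp x) * T.a y =
      (RatFunc.X ^ D.wt y (D.kExp x) : RatFunc ℚ) • (T.a y * (c • T.k (D.kExp x))) := by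
  rw [smul_mul_assoc, T.k_a, mul_smul_comm, smul_comm]

lemma k_neg_kExp_mul (x y : D.IInf) (c : RatFunc ℚ) :
    c • T.k (-D.kExp x) * T.a y =
      (RatFunc.X ^ (-D.wt y (D.kExp x)) : RatFunc ℚ) • (T.a y * (c • T.k (-D.kExp x))) := by
  rw [smul_mul_assoc, T.k_a, mul_smul_comm, smul_comm, wt_neg]

/-- The letter `z` can meet the powers of `a_i`, the middle factor `y`, or neither. The first case
uses the ratio of consecutive binomials, the second their vanishing alternating sums, and the third
leaves no remainder. -/
lemma serreIn_mul (i : I) (hi : D.A i i = 2) (y : D.IInf) (hy : D.reIdx i hi ≠ y) (z : D.IInf) :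
    D.serreIn T.a i hi y * T.b z = (D.sgn (D.reIdx i hi) z ^ D.serreExp i y * D.sgn y z) •
      (T.b z * D.serreIn T.a i hi y) := by
  have hε := D.eps_mul_self i
  have hQ := D.qi_ne_zero i
  have hN := D.eps_pow_serreExp hy
  have hNc := D.serreExp_cast hy
  have hb := D.superBracket_qi_ne_zero i (D.serreExp_ne_zero hy)
  have hf0 := D.qBinom_zero i (1 - (y.1.2 : ℤ) * D.A i y.1.1)
  have hf := D.qBinom_succ i (1 - (y.1.2 : ℤ) * D.A i y.1.1)
  have hX : ∀ m : ℤ, (RatFunc.X : RatFunc ℚ) ^ (D.d i * m) = D.qi i ^ m := fun m => by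
    rw [qi, zpow_mul, zpow_natCast]
  -- The weight of `y` under `K_i` is governed by `k a_{ij} = 1 - N`, where `N` is the Serre
  -- exponent; this links commutation with `K_i` to the binomial identities.
  have hwy : D.wt y (D.kExp (D.reIdx i hi)) = D.d i * (1 - D.serreExp i y) := by
    rw [wt_kExp, hNc]; simp only [reIdx]; push_cast; ring
  have hwi : D.wt (D.reIdx i hi) (D.kExp (D.reIdx i hi)) = D.d i * 2 := by
    rw [wt_kExp]; simp only [reIdx, hi]; push_cast; ring
  have hs := D.sgn_mul_self (D.reIdx i hi) y
  have hco := D.serreCoeff_eq i hi y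
  rw [← hNc] at hf hf0 hco
  by_cases hzi : D.reIdx i hi = z
  · subst hzi
    have h1 : D.eps i * D.qi i ^ 2 - 1 ≠ 0 := by
      have := geom_mul_eq_superBracket (ε := D.eps i) hQ 1
      rw [Finset.sum_range_one, pow_zero, one_mul] at this
      rw [this]
      exact mul_ne_zero (pow_ne_zero _ hQ) (D.superBracket_qi_ne_zero i one_ne_zero)
    have h2 : D.eps i * (D.qi i ^ 2)⁻¹ - 1 ≠ 0 := by
      have := geom_inv_mul_eq_superBracket hε hQ 1
      rw [Finset.sum_range_one, pow_zero, one_mul] at this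
      rw [this]
      exact neg_ne_zero.2 (mul_ne_zero (pow_ne_zero _ (mul_ne_zero
        (left_ne_zero_of_mul_eq_one hε) (inv_ne_zero hQ)))
        (D.superBracket_qi_ne_zero i one_ne_zero))
    have hab := T.ab_self (D.reIdx i hi)
    rw [sgn_reIdx_self] at hab ⊢
    have hyb := T.ab_ne y (D.reIdx i hi) hy.symm
    refine serreSum_mul_self hab hyb (c := D.qi i ^ 2) (c' := (D.qi i ^ 2)⁻¹)
      (d := D.qi i ^ (1 - D.serreExp i y : ℤ)) (d' := D.qi i ^ (-(1 - D.serreExp i y) : ℤ))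
      ?_ ?_ ?_ ?_ ?_ ?_
    · rw [k_kExp_mul, hwi, hX]; rfl
    · rw [k_neg_kExp_mul, hwi, ← mul_neg, hX, zpow_neg]; rfl
    · rw [k_kExp_mul, hwy, hX]
    · rw [k_neg_kExp_mul, hwy, ← mul_neg, hX]
    · intro t ht
      have h := geom_mul_binom_eq hQ h1 ht (f := D.qBinom i (D.serreExp i y) t)
        (f' := D.qBinom i (D.serreExp i y) (t + 1)) (by rw [hf t, Nat.cast_sub ht.le])
      have e : D.qi i ^ (1 - D.serreExp i y : ℤ) * (D.qi i ^ 2) ^ t =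
          D.qi i ^ (1 - D.serreExp i y + 2 * t : ℤ) := by
        rw [zpow_add₀ hQ, zpow_mul, zpow_natCast]; rfl
      rw [e, hco, hco, sign_choose_succ, D.sgn_comm y]
      linear_combination ((-1) ^ t * D.sgn (D.reIdx i hi) y ^ (t + 1) * D.eps i ^ t.choose 2 *
        D.eps i ^ t) * h
    · intro t ht
      have h := geom_inv_mul_binom_eq hε hQ h2 ht hN (f := D.qBinom i (D.serreExp i y) t)
        (f' := D.qBinom i (D.serreExp i y) (t + 1)) (by rw [hf t, Nat.cast_sub ht.le])
      have e : D.qi i ^ (-(1 - D.serreExp i y) : ℤ) * ((D.qi i ^ 2)⁻¹) ^ t =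
          D.qi i ^ (-(1 - D.serreExp i y + 2 * t) : ℤ) := by
        rw [neg_add, zpow_add₀ hQ, ← mul_neg, zpow_mul, inv_pow, zpow_neg (D.qi i ^ (2 : ℤ)),
          zpow_natCast]
        rfl
      rw [e, hco, hco, sign_choose_succ, D.sgn_comm y]
      linear_combination ((-1) ^ t * D.sgn (D.reIdx i hi) y ^ (t + 1) * D.eps i ^ t.choose 2 *
        D.eps i ^ t) * h
  -- The sign built into the Serre coefficient cancels the sign from moving `b` past `a_i ^ t`.
  · have hsum : ∀ e : RatFunc ℚ, ∑ t ∈ Finset.range (D.serreExp i y + 1),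
        (-1) ^ t * D.eps i ^ t.choose 2 * D.qBinom i (D.serreExp i y) t * e ^ t = 0 →
        ∑ t ∈ Finset.range (D.serreExp i y + 1),
          D.serreCoeff i y t * (D.sgn (D.reIdx i hi) y * e) ^ t = 0 := by
      intro e he
      rw [← he]
      refine Finset.sum_congr rfl fun t _ => ?_
      have h1 : D.sgn (D.reIdx i hi) y ^ t * D.sgn (D.reIdx i hi) y ^ t = 1 := by
        rw [← mul_pow, hs, one_pow]
      rw [hco, mul_pow]
      linear_combination ((-1) ^ t * D.eps i ^ t.choose 2 * D.qBinom i (D.serreExp i y) t * e ^ t)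
        * h1
    have hs1 := hsum _ (alternating_binom_sum_eq_zero hε hQ hN hb _ hf0 hf)
    have hs2 := hsum _ (alternating_binom_sum_eq_zero' hε hQ hN hb _ hf0 hf)
    by_cases hzy : y = z
    · subst hzy
      refine serreSum_mul_other (T.ab_ne _ _ hzi) (T.ab_self y) ?_ ?_ hs1 hs2
      · rw [k_kExp_mul, wt_kExp_symm, hwy, hX]
      · rw [k_neg_kExp_mul, wt_kExp_symm, hwy, ← mul_neg, hX, neg_sub]
    -- With zero remainders `c` and `c'` are free; they are chosen so that the sums reduce to the
    -- one already known to vanish.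
    · refine serreSum_mul_other (K := 0) (K' := 0) (T.ab_ne _ _ hzi)
        (c := D.sgn (D.reIdx i hi) z * (D.sgn (D.reIdx i hi) y * D.qi i ^ (1 - D.serreExp i y : ℤ)))
        (c' := D.sgn (D.reIdx i hi) z * (D.sgn (D.reIdx i hi) y * D.qi i ^ (1 - D.serreExp i y : ℤ)))
        (by rw [T.ab_ne _ _ hzy, sub_zero, add_zero]) (by simp) (by simp) ?_ ?_ <;>
      simpa only [← mul_assoc, sgn_mul_self, one_mul] using hs1

/-- Since `a_{ij} = 0`, the `K`-terms created by one factor commute with the other factor, so the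
corrections from the two orders can be compared and cancel. -/
lemma commIn_mul (x y : D.IInf) (hxy : D.A x.1.1 y.1.1 = 0) (z : D.IInf) :
    D.commIn T.a x y * T.b z = (D.sgn x z * D.sgn y z) • (T.b z * D.commIn T.a x y) := by
  have hwx : D.wt y (D.kExp x) = 0 := by rw [wt_kExp, hxy]; ring
  have hwy : D.wt x (D.kExp y) = 0 := by rw [wt_kExp_symm, hwx]
  have hcx : ∀ c : RatFunc ℚ, c • T.k (D.kExp x) * T.a y = T.a y * (c • T.k (D.kExp x)) :=
    fun c => by rw [k_kExp_mul, hwx, zpow_zero, one_smul]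
  have hcy : ∀ c : RatFunc ℚ, c • T.k (D.kExp y) * T.a x = T.a x * (c • T.k (D.kExp y)) :=
    fun c => by rw [k_kExp_mul, hwy, zpow_zero, one_smul]
  have hcx' : ∀ c : RatFunc ℚ, c • T.k (-D.kExp x) * T.a y = T.a y * (c • T.k (-D.kExp x)) :=
    fun c => by rw [k_neg_kExp_mul, hwx, neg_zero, zpow_zero, one_smul]
  have hcy' : ∀ c : RatFunc ℚ, c • T.k (-D.kExp y) * T.a x = T.a x * (c • T.k (-D.kExp y)) :=
    fun c => by rw [k_neg_kExp_mul, hwy, neg_zero, zpow_zero, one_smul]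
  obtain ⟨C, hx, hCx⟩ : ∃ C, T.a x * T.b z = D.sgn x z • (T.b z * T.a x) + C ∧
      C * T.a y = T.a y * C ∧ (x ≠ z → C = 0) := by
    by_cases h : x = z
    · subst h
      exact ⟨_, T.ab_self x, by rw [sub_mul, mul_sub, hcx, hcx'], fun h => absurd rfl h⟩
    · exact ⟨0, by rw [T.ab_ne _ _ h, add_zero], by simp, fun _ => rfl⟩
  obtain ⟨C', hy, hCy⟩ : ∃ C, T.a y * T.b z = D.sgn y z • (T.b z * T.a y) + C ∧
      C * T.a x = T.a x * C ∧ (y ≠ z → C = 0) := by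
    by_cases h : y = z
    · subst h
      exact ⟨_, T.ab_self y, by rw [sub_mul, mul_sub, hcy, hcy'], fun h => absurd rfl h⟩
    · exact ⟨0, by rw [T.ab_ne _ _ h, add_zero], by simp, fun _ => rfl⟩
  -- The correction `C` can be nonzero only when `z = x`, and then the two signs agree.
  have e1 : D.sgn y z • C = D.sgn x y • C := by
    by_cases h : x = z
    · rw [← h, D.sgn_comm]
    · rw [hCx.2 h, smul_zero, smul_zero]
  have e2 : (D.sgn x y * D.sgn x z) • C' = C' := by
    by_cases h : y = z
    · rw [← h, sgn_mul_self, one_smul]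
    · rw [hCy.2 h, smul_zero]
  have f1 : T.a x * T.a y * T.b z = (D.sgn x z * D.sgn y z) • (T.b z * (T.a x * T.a y)) +
      (D.sgn x y • (T.a y * C) + T.a x * C') := by
    rw [mul_assoc, hy, mul_add, mul_smul_comm, ← mul_assoc, hx, add_mul, smul_add, hCx.1,
      ← mul_smul_comm (D.sgn y z) (T.a y) C, e1, smul_mul_assoc, mul_assoc, mul_smul_comm,
      smul_smul, mul_comm (D.sgn y z)]
    abel
  have f2 : T.a y * T.a x * T.b z = (D.sgn x z * D.sgn y z) • (T.b z * (T.a y * T.a x)) +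
      (D.sgn x z • (T.a x * C') + T.a y * C) := by
    rw [mul_assoc, hx, mul_add, mul_smul_comm, ← mul_assoc, hy, add_mul, smul_add, hCy.1,
      smul_mul_assoc, mul_assoc, smul_smul]
    abel
  have f3 : D.sgn x y • D.sgn x z • (T.a x * C') = T.a x * C' := by
    rw [smul_smul, ← mul_smul_comm, e2]
  rw [commIn, sub_mul, smul_mul_assoc, f1, f2, smul_add, smul_add, f3, mul_sub, mul_smul_comm, smul_sub,
    smul_comm (D.sgn x y) (D.sgn x z * D.sgn y z)]
  abel

/-- The relators of the positive part skew-commute with the negative part. -/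
lemma relator_mul (r : D.RelIdx) (z : D.IInf) :
    ∃ c : RatFunc ℚ, c ≠ 0 ∧ D.relator T.a r * T.b z = c • (T.b z * D.relator T.a r) := by
  have hs : ∀ x y, D.sgn x y ≠ 0 := fun x y => left_ne_zero_of_mul_eq_one (D.sgn_mul_self x y)
  cases r with
  | serre i hi y hy =>
    exact ⟨_, mul_ne_zero (pow_ne_zero _ (hs _ _)) (hs _ _), T.serreIn_mul i hi y hy z⟩
  | comm x y hxy => exact ⟨_, mul_ne_zero (hs _ _) (hs _ _), T.commIn_mul x y hxy z⟩

/-- The relators of the negative part skew-commute with the positive part. -/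
lemma mul_relator (r : D.RelIdx) (z : D.IInf) :
    ∃ c : RatFunc ℚ, T.a z * D.relator T.b r = c • (D.relator T.b r * T.a z) := by
  obtain ⟨c, hc, h⟩ := T.swap.relator_mul r z
  exact ⟨c⁻¹, by rw [show D.relator T.b r * T.a z = c • (T.a z * D.relator T.b r) from h,
    smul_smul, inv_mul_cancel₀ hc, one_smul]⟩

end TriRep

end

/-! ### The induced module on words and its operators. -/

/-- The scalar `(1 - (-1)^{p(li)} q_i^{2l})⁻¹`. -/
def kappa (x : D.IInf) : RatFunc ℚ := (1 - (-1) ^ D.pInf x * D.qi x.1.1 ^ (2 * x.1.2))⁻¹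

/-- The module induced from `U^0 ⊗ Z` along the free negative part, where `Z` is an algebra
containing elements `a_{il}`: a basis element `((w, h), z)` stands for the product of the word `w`
in the `b_{il}`, of `q^h` and of `z`. -/
abbrev Verma (Z : Type*) [Zero Z] : Type _ := (List D.IInf × Module.Dual ℤ P) →₀ Z

variable (Z : Type*) [Ring Z] [Algebra (RatFunc ℚ) Z]

/-- The weight of a word in the `b_{il}`, up to sign. -/
def wordWt (w : List D.IInf) (h : Module.Dual ℤ P) : ℤ := (w.map fun x => D.wt x h).sum

lemma wordWt_cons (y : D.IInf) (w : List D.IInf) (h : Module.Dual ℤ P) :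
    D.wordWt (y :: w) h = D.wt y h + D.wordWt w h := by simp [wordWt]

lemma wordWt_add (w : List D.IInf) (h h' : Module.Dual ℤ P) :
    D.wordWt w (h + h') = D.wordWt w h + D.wordWt w h' := by
  simp [wordWt, wt_add, List.sum_map_add]

/-- The action of `b_{il}`. -/
def bOp (y : D.IInf) : Module.End (RatFunc ℚ) (D.Verma Z) :=
  Finsupp.lmapDomain _ _ fun p => (y :: p.1, p.2)

/-- The action of `q^h`. -/
def kOp (h : Module.Dual ℤ P) : Module.End (RatFunc ℚ) (D.Verma Z) :=
  Finsupp.lsum (RatFunc ℚ) fun p =>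
    (RatFunc.X ^ (-D.wordWt p.1 h) : RatFunc ℚ) • Finsupp.lsingle (p.1, h + p.2)

variable {Z} (aP : D.IInf → Z)

open Classical in
/-- The action of `a_{il}` on words, moving it to the right through the `b_{jk}`. -/
def aOpAux (x : D.IInf) (h : Module.Dual ℤ P) : List D.IInf → Z →ₗ[RatFunc ℚ] D.Verma Z
  -- The scalar is the cost of moving `a_{il}` to the right past `q^h`.
  | [] => (RatFunc.X ^ (-D.wt x h) : RatFunc ℚ) •
      (Finsupp.lsingle ([], h) ∘ₗ LinearMap.mulLeft _ (aP x))
  | y :: w => D.sgn x y • (D.bOp Z y ∘ₗ aOpAux x h w) +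
      if x = y then (D.kappa x • D.kOp Z (D.kExp x) - D.kappa x • D.kOp Z (-D.kExp x)) ∘ₗ
        Finsupp.lsingle (w, h) else 0

/-- The action of `a_{il}`. -/
def aOp (x : D.IInf) : Module.End (RatFunc ℚ) (D.Verma Z) :=
  Finsupp.lsum (RatFunc ℚ) fun p => D.aOpAux aP x p.2 p.1

lemma bOp_single (y : D.IInf) (w : List D.IInf) (h : Module.Dual ℤ P) (z : Z) :
    D.bOp Z y (Finsupp.single (w, h) z) = Finsupp.single (y :: w, h) z := by
  simp [bOp, Finsupp.mapDomain_single]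

lemma kOp_single (h' : Module.Dual ℤ P) (w : List D.IInf) (h : Module.Dual ℤ P) (z : Z) :
    D.kOp Z h' (Finsupp.single (w, h) z) =
      (RatFunc.X ^ (-D.wordWt w h') : RatFunc ℚ) • Finsupp.single (w, h' + h) z := by
  rw [kOp, Finsupp.lsum_single]; rfl

lemma aOp_single_nil (x : D.IInf) (h : Module.Dual ℤ P) (z : Z) :
    D.aOp aP x (Finsupp.single ([], h) z) =
      (RatFunc.X ^ (-D.wt x h) : RatFunc ℚ) • Finsupp.single ([], h) (aP x * z) := by
  rw [aOp, Finsupp.lsum_single]; rfl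

/-- An extensionality principle for operators on the induced module. -/
lemma verma_ext {N : Type*} [AddCommGroup N] [Module (RatFunc ℚ) N] {f g : D.Verma Z →ₗ[RatFunc ℚ] N}
    (hfg : ∀ w h z, f (Finsupp.single (w, h) z) = g (Finsupp.single (w, h) z)) : f = g :=
  Finsupp.lhom_ext fun p z => hfg p.1 p.2 z

lemma kOp_mul_bOp (h : Module.Dual ℤ P) (y : D.IInf) :
    D.kOp Z h * D.bOp Z y = (RatFunc.X ^ (-D.wt y h) : RatFunc ℚ) • (D.bOp Z y * D.kOp Z h) := by
  refine D.verma_ext fun w h' z => ?_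
  rw [LinearMap.smul_apply, Module.End.mul_apply, Module.End.mul_apply, bOp_single, kOp_single,
    kOp_single, map_smul, bOp_single, smul_smul, wordWt_cons, neg_add,
    zpow_add₀ RatFunc.X_ne_zero]

lemma kOp_mul (h h' : Module.Dual ℤ P) : D.kOp Z h * D.kOp Z h' = D.kOp Z (h + h') := by
  refine D.verma_ext fun w h'' z => ?_
  rw [Module.End.mul_apply, kOp_single, map_smul, kOp_single, kOp_single, smul_smul, wordWt_add,
    neg_add_rev, zpow_add₀ RatFunc.X_ne_zero, add_assoc]

lemma kOp_zero : D.kOp Z 0 = 1 := by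
  refine D.verma_ext fun w h z => ?_
  have : D.wordWt w 0 = 0 := by simp [wordWt, wt_zero]
  rw [kOp_single, this, neg_zero, zpow_zero, one_smul, zero_add, Module.End.one_apply]

lemma aOp_mul_bOp_of_ne (x y : D.IInf) (hxy : x ≠ y) :
    D.aOp aP x * D.bOp Z y = D.sgn x y • (D.bOp Z y * D.aOp aP x) := by
  refine D.verma_ext fun w h z => ?_
  rw [LinearMap.smul_apply, Module.End.mul_apply, Module.End.mul_apply, bOp_single, aOp,
    Finsupp.lsum_single, Finsupp.lsum_single, aOpAux, if_neg hxy, add_zero]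
  rfl

lemma aOp_mul_bOp_self (x : D.IInf) :
    D.aOp aP x * D.bOp Z x = D.sgn x x • (D.bOp Z x * D.aOp aP x) +
      (D.kappa x • D.kOp Z (D.kExp x) - D.kappa x • D.kOp Z (-D.kExp x)) := by
  refine D.verma_ext fun w h z => ?_
  rw [LinearMap.add_apply, LinearMap.smul_apply, Module.End.mul_apply, Module.End.mul_apply,
    bOp_single, aOp, Finsupp.lsum_single, Finsupp.lsum_single, aOpAux, if_pos rfl]
  rfl

/-- Induction on the word. For the empty word it is the normalization of `aOp`; when a letter `b_x`
meets `a_x`, their weights cancel, in agreement with the `K`-terms commuting with `q^h`. -/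
lemma kOp_mul_aOp (h : Module.Dual ℤ P) (x : D.IInf) :
    D.kOp Z h * D.aOp aP x = (RatFunc.X ^ D.wt x h : RatFunc ℚ) • (D.aOp aP x * D.kOp Z h) := by
  have hX : (RatFunc.X : RatFunc ℚ) ≠ 0 := RatFunc.X_ne_zero
  refine D.verma_ext fun w h' z => ?_
  induction w with
  | nil =>
    rw [LinearMap.smul_apply, Module.End.mul_apply, Module.End.mul_apply, aOp_single_nil,
      map_smul, kOp_single, kOp_single, map_smul, aOp_single_nil, smul_smul, smul_smul, smul_smul,
      wt_add, neg_add, zpow_add₀ hX]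
    congr 1
    have : (RatFunc.X : RatFunc ℚ) ^ D.wt x h * RatFunc.X ^ (-D.wt x h) = 1 := by
      rw [← zpow_add₀ hX, add_neg_cancel, zpow_zero]
    linear_combination (-RatFunc.X ^ (-D.wt x h') * RatFunc.X ^ (-D.wordWt [] h)) * this
  | cons y w ih =>
    have ih' : D.kOp Z h (D.aOp aP x (Finsupp.single (w, h') z)) =
        (RatFunc.X ^ D.wt x h : RatFunc ℚ) • D.aOp aP x (D.kOp Z h (Finsupp.single (w, h') z)) := ih
    have hkb : ∀ m, D.kOp Z h (D.bOp Z y m) =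
        (RatFunc.X ^ (-D.wt y h) : RatFunc ℚ) • D.bOp Z y (D.kOp Z h m) :=
      LinearMap.congr_fun (D.kOp_mul_bOp h y)
    have hkk : ∀ h' m, D.kOp Z h (D.kOp Z h' m) = D.kOp Z h' (D.kOp Z h m) := fun h' m => by
      rw [← Module.End.mul_apply, ← Module.End.mul_apply, kOp_mul, kOp_mul, add_comm]
    rw [← bOp_single, LinearMap.smul_apply, Module.End.mul_apply, Module.End.mul_apply, hkb,
      map_smul]
    by_cases hxy : x = y
    · subst hxy
      have hab : ∀ m, D.aOp aP x (D.bOp Z x m) = D.sgn x x • D.bOp Z x (D.aOp aP x m) +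
          (D.kappa x • D.kOp Z (D.kExp x) m - D.kappa x • D.kOp Z (-D.kExp x) m) :=
        LinearMap.congr_fun (D.aOp_mul_bOp_self aP x)
      rw [hab, hab, map_add, map_sub, map_smul, map_smul, map_smul, hkb, ih', hkk, hkk, map_smul,
        smul_smul (RatFunc.X ^ D.wt x h), ← zpow_add₀ hX, add_neg_cancel, zpow_zero, one_smul,
        smul_smul (RatFunc.X ^ (-D.wt x h)), ← zpow_add₀ hX, neg_add_cancel, zpow_zero, one_smul]
    · have hab : ∀ m, D.aOp aP x (D.bOp Z y m) = D.sgn x y • D.bOp Z y (D.aOp aP x m) :=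
        LinearMap.congr_fun (D.aOp_mul_bOp_of_ne aP x y hxy)
      rw [hab, hab, map_smul, hkb, ih', map_smul]
      simp only [smul_smul]
      congr 1
      ring

/-- The induced module as a representation of the generators. -/
def vermaRep : D.TriRep (Module.End (RatFunc ℚ) (D.Verma Z)) where
  a := D.aOp aP
  b := D.bOp Z
  k := D.kOp Z
  κ := D.kappa
  k_a := D.kOp_mul_aOp aP
  k_b := D.kOp_mul_bOp
  ab_ne := D.aOp_mul_bOp_of_ne aP
  ab_self := D.aOp_mul_bOp_self aP

/-- On the empty word the operators are left multiplications by `aP` up to scalars, so the relator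
is a multiple of one that vanishes in `Z`. Skew-commutation with the `bOp` carries this to longer
words. -/
lemma relator_aOp (haP : ∀ r, D.relator aP r = 0) (r : D.RelIdx) : D.relator (D.aOp aP) r = 0 := by
  refine D.verma_ext fun w h z => ?_
  rw [LinearMap.zero_apply]
  induction w with
  | nil =>
    obtain ⟨c, hc, hr⟩ := D.exists_relator_intertwine
      (f := (Finsupp.lsingle ([], h) : Z →ₗ[RatFunc ℚ] D.Verma Z))
      (g := fun x => Algebra.lmul (RatFunc ℚ) Z (aP x)) (g' := D.aOp aP)
      (χ := fun x => RatFunc.X ^ D.wt x h) (fun x => zpow_ne_zero _ RatFunc.X_ne_zero)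
      (fun x m => by
        rw [Finsupp.lsingle_apply, Finsupp.lsingle_apply, aOp_single_nil, smul_smul,
          ← zpow_add₀ RatFunc.X_ne_zero, add_neg_cancel, zpow_zero, one_smul]
        rfl) r
    have h1 := hr z
    rw [← D.map_relator (Algebra.lmul (RatFunc ℚ) Z), haP, map_zero,
      LinearMap.zero_apply, map_zero] at h1
    exact (smul_eq_zero.1 h1.symm).resolve_left hc
  | cons y w ih =>
    obtain ⟨c, -, hr⟩ := (D.vermaRep aP).relator_mul r y
    have h1 := LinearMap.congr_fun hr (Finsupp.single (w, h) z)
    have h2 : D.relator (D.aOp aP) r (D.bOp Z y (Finsupp.single (w, h) z)) =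
      c • D.bOp Z y (D.relator (D.aOp aP) r (Finsupp.single (w, h) z)) := h1
    rw [← bOp_single, h2, ih, map_zero, smul_zero]

/-! ### The generators and relators inside `U` and its three subalgebras. -/

instance : Ring D.U := RingQuot.instRing _

instance : Ring D.UPos := D.UPos.toRing

instance : Ring D.UZero := D.UZero.toRing

instance : Ring D.UNeg := D.UNeg.toRing

lemma gen_q_zero : D.gen (.qpow 0) = 1 :=
  (RingQuot.mkAlgHom_rel (RatFunc ℚ) Rel.q_zero).trans (map_one _)

lemma gen_q_mul (h h' : Module.Dual ℤ P) :
    D.gen (.qpow h) * D.gen (.qpow h') = D.gen (.qpow (h + h')) :=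
  (map_mul D.mkU _ _).symm.trans (RingQuot.mkAlgHom_rel (RatFunc ℚ) (Rel.q_add h h'))

/-- `q^h x q^{-h} = c x` means `q^h x = c x q^h`. -/
lemma q_mul_of_conj {h : Module.Dual ℤ P} {x : D.U} {c : RatFunc ℚ}
    (hx : D.gen (.qpow h) * x * D.gen (.qpow (-h)) = c • x) :
    D.gen (.qpow h) * x = c • (x * D.gen (.qpow h)) := by
  rw [← smul_mul_assoc, ← hx, mul_assoc _ (D.gen _) (D.gen _), gen_q_mul, neg_add_cancel,
    gen_q_zero, mul_one]

/-- The generators of `U_q(𝔤)` satisfy the relations of a `TriRep`. -/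
def uRep : D.TriRep D.U where
  a x := D.gen (.a x)
  b x := D.gen (.b x)
  k h := D.gen (.qpow h)
  κ := D.kappa
  k_a h x := by
    have := RingQuot.mkAlgHom_rel (RatFunc ℚ) (Rel.q_a (D := D) h x)
    rw [map_mul, map_mul, map_smul] at this
    exact D.q_mul_of_conj this
  k_b h x := by
    have := RingQuot.mkAlgHom_rel (RatFunc ℚ) (Rel.q_b (D := D) h x)
    rw [map_mul, map_mul, map_smul] at this
    exact D.q_mul_of_conj this
  ab_ne x y hxy := by
    have := RingQuot.mkAlgHom_rel (RatFunc ℚ) (Rel.ab_ne (D := D) x y hxy)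
    rw [map_superComm, map_zero, sub_eq_zero] at this
    exact this
  ab_self x := by
    have := RingQuot.mkAlgHom_rel (RatFunc ℚ) (Rel.ab_self (D := D) x)
    rw [map_superComm, map_smul, map_sub, sub_eq_iff_eq_add', smul_sub] at this
    exact this

lemma relator_gen_a (r : D.RelIdx) : D.relator (fun x => D.gen (.a x)) r = 0 := by
  have h := D.map_relator D.mkU D.fa r
  refine h.symm.trans ?_
  cases r with
  | serre i hi y hy =>
    exact (RingQuot.mkAlgHom_rel (RatFunc ℚ) (Rel.serre_a i hi y hy)).trans (map_zero _)
  | comm x y hxy =>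
    exact (RingQuot.mkAlgHom_rel (RatFunc ℚ) (Rel.comm_a x y hxy)).trans (map_zero _)

lemma relator_gen_b (r : D.RelIdx) : D.relator (fun x => D.gen (.b x)) r = 0 := by
  have h := D.map_relator D.mkU D.fb r
  refine h.symm.trans ?_
  cases r with
  | serre i hi y hy =>
    exact (RingQuot.mkAlgHom_rel (RatFunc ℚ) (Rel.serre_b i hi y hy)).trans (map_zero _)
  | comm x y hxy =>
    exact (RingQuot.mkAlgHom_rel (RatFunc ℚ) (Rel.comm_b x y hxy)).trans (map_zero _)

/-- The generators `a_{il}`, `b_{il}`, `q^h` as elements of `U^+`, `U^-` and `U^0`. -/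
def aPos (x : D.IInf) : D.UPos := ⟨D.gen (.a x), Algebra.subset_adjoin ⟨x, rfl⟩⟩

def bNeg (x : D.IInf) : D.UNeg := ⟨D.gen (.b x), Algebra.subset_adjoin ⟨x, rfl⟩⟩

def qZero (h : Module.Dual ℤ P) : D.UZero := ⟨D.gen (.qpow h), Algebra.subset_adjoin ⟨h, rfl⟩⟩

lemma relator_aPos (r : D.RelIdx) : D.relator D.aPos r = 0 :=
  Subtype.val_injective ((D.map_relator D.UPos.val D.aPos r).trans (D.relator_gen_a r))

lemma relator_bNeg (r : D.RelIdx) : D.relator D.bNeg r = 0 :=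
  Subtype.val_injective ((D.map_relator D.UNeg.val D.bNeg r).trans (D.relator_gen_b r))

/-! ### The quotient by the negative relators as a module over `U`. -/

section Quotient

variable (Z : Type*) [Ring Z] [Algebra (RatFunc ℚ) Z]

/-- The submodule of the induced module generated by the relators of the negative part. -/
def relSubmodule : Submodule (RatFunc ℚ) (D.Verma Z) :=
  Submodule.span _ {m | ∃ (w : List D.IInf) (r : D.RelIdx) (m' : D.Verma Z),
    (w.map (D.bOp Z)).prod (D.relator (D.bOp Z) r m') = m}

variable {Z}

lemma word_relator_mem (w : List D.IInf) (r : D.RelIdx) (m : D.Verma Z) :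
    (w.map (D.bOp Z)).prod (D.relator (D.bOp Z) r m) ∈ D.relSubmodule Z :=
  Submodule.subset_span ⟨w, r, m, rfl⟩

lemma bOp_mem {m : D.Verma Z} (hm : m ∈ D.relSubmodule Z) (y : D.IInf) :
    D.bOp Z y m ∈ D.relSubmodule Z := by
  have : D.relSubmodule Z ≤ (D.relSubmodule Z).comap (D.bOp Z y) := by
    refine Submodule.span_le.2 ?_
    rintro _ ⟨w, r, m', rfl⟩
    exact D.word_relator_mem (y :: w) r m'
  exact this hm

/-- The operator `q^h` rescales each `bOp`, hence passes through every relator up to a scalar. -/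
lemma kOp_mem {m : D.Verma Z} (hm : m ∈ D.relSubmodule Z) (h : Module.Dual ℤ P) :
    D.kOp Z h m ∈ D.relSubmodule Z := by
  have hkb : ∀ y m, D.kOp Z h (D.bOp Z y m) =
      (RatFunc.X ^ (-D.wt y h) : RatFunc ℚ) • D.bOp Z y (D.kOp Z h m) := fun y =>
    LinearMap.congr_fun (D.kOp_mul_bOp h y)
  have : D.relSubmodule Z ≤ (D.relSubmodule Z).comap (D.kOp Z h) := by
    refine Submodule.span_le.2 ?_
    rintro _ ⟨w, r, m', rfl⟩
    change D.kOp Z h _ ∈ D.relSubmodule Z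
    induction w with
    | nil =>
      obtain ⟨c, -, hr⟩ := D.exists_relator_intertwine (f := D.kOp Z h)
        (fun y => zpow_ne_zero _ RatFunc.X_ne_zero) hkb r
      rw [List.map_nil, List.prod_nil, Module.End.one_apply, hr]
      exact Submodule.smul_mem _ _ (D.word_relator_mem [] r _)
    | cons y w ih =>
      rw [List.map_cons, List.prod_cons, Module.End.mul_apply, hkb]
      exact Submodule.smul_mem _ _ (D.bOp_mem ih y)
  exact this hm

variable (aP : D.IInf → Z)

/-- Induction on the prefix word: `a` passes through the bare relator by `mul_relator`, and passing
a letter `b` costs at most `K`-terms, under which the submodule is already stable. -/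
lemma aOp_mem {m : D.Verma Z} (hm : m ∈ D.relSubmodule Z) (x : D.IInf) :
    D.aOp aP x m ∈ D.relSubmodule Z := by
  have : D.relSubmodule Z ≤ (D.relSubmodule Z).comap (D.aOp aP x) := by
    refine Submodule.span_le.2 ?_
    rintro _ ⟨w, r, m', rfl⟩
    change D.aOp aP x _ ∈ D.relSubmodule Z
    induction w with
    | nil =>
      obtain ⟨c, hr⟩ := (D.vermaRep aP).mul_relator r x
      have h1 : D.aOp aP x (D.relator (D.bOp Z) r m') =
        c • D.relator (D.bOp Z) r (D.aOp aP x m') := LinearMap.congr_fun hr m'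
      rw [List.map_nil, List.prod_nil, Module.End.one_apply, h1]
      exact Submodule.smul_mem _ _ (D.word_relator_mem [] r _)
    | cons y w ih =>
      rw [List.map_cons, List.prod_cons, Module.End.mul_apply, ← Module.End.mul_apply]
      have hm := D.word_relator_mem w r m'
      by_cases hxy : x = y
      · subst hxy
        rw [aOp_mul_bOp_self]
        exact Submodule.add_mem _ (Submodule.smul_mem _ _ (D.bOp_mem ih x))
          (Submodule.sub_mem _ (Submodule.smul_mem _ _ (D.kOp_mem hm _))
            (Submodule.smul_mem _ _ (D.kOp_mem hm _)))
      · rw [D.aOp_mul_bOp_of_ne aP x y hxy]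
        exact Submodule.smul_mem _ _ (D.bOp_mem ih y)
  exact this hm

/-- The operators on the induced module attached to the generators. -/
def genOp : D.Gen → Module.End (RatFunc ℚ) (D.Verma Z)
  | .a x => D.aOp aP x
  | .b x => D.bOp Z x
  | .qpow h => D.kOp Z h

lemma genOp_mem (g : D.Gen) {m : D.Verma Z} (hm : m ∈ D.relSubmodule Z) :
    D.genOp aP g m ∈ D.relSubmodule Z := by
  cases g with
  | a x => exact D.aOp_mem aP hm x
  | b x => exact D.bOp_mem hm x
  | qpow h => exact D.kOp_mem hm h

/-- The action of the free algebra on the induced module. -/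
def freeAct : D.Free →ₐ[RatFunc ℚ] Module.End (RatFunc ℚ) (D.Verma Z) :=
  FreeAlgebra.lift _ (D.genOp aP)

/-- The action of the free algebra on the quotient of the induced module. -/
def freeActQuot : D.Free →ₐ[RatFunc ℚ] Module.End (RatFunc ℚ) (D.Verma Z ⧸ D.relSubmodule Z) :=
  FreeAlgebra.lift _ fun g => (D.relSubmodule Z).mapQ (D.relSubmodule Z) (D.genOp aP g)
    fun _ => D.genOp_mem aP g

lemma freeAct_ι (g : D.Gen) : D.freeAct aP (FreeAlgebra.ι _ g) = D.genOp aP g := by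
  simp [freeAct]

lemma freeActQuot_mk (u : D.Free) (m : D.Verma Z) :
    D.freeActQuot aP u ((D.relSubmodule Z).mkQ m) = (D.relSubmodule Z).mkQ (D.freeAct aP u m) := by
  induction u using FreeAlgebra.induction generalizing m with
  | grade0 c => simp
  | grade1 g => simp [freeAct_ι, freeActQuot]
  | mul u v hu hv => simp only [map_mul, Module.End.mul_apply, hu, hv]
  | add u v hu hv => simp only [map_add, LinearMap.add_apply, hu, hv]

/-- All relations but two hold as identities of operators; the Serre and commutation relations among
the `b` hold only modulo the submodule. -/
lemma freeAct_rel (haP : ∀ r, D.relator aP r = 0) {u v : D.Free} (huv : D.Rel u v)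
    (m : D.Verma Z) :
    D.freeAct aP u m - D.freeAct aP v m ∈ D.relSubmodule Z := by
  have ha : ∀ x, D.freeAct aP (D.fa x) = D.aOp aP x := fun x => D.freeAct_ι aP (.a x)
  have hb : ∀ x, D.freeAct aP (D.fb x) = D.bOp Z x := fun x => D.freeAct_ι aP (.b x)
  have hq : ∀ h, D.freeAct aP (D.fq h) = D.kOp Z h := fun h => D.freeAct_ι aP (.qpow h)
  have hkk : ∀ h, D.kOp Z h * D.kOp Z (-h) = 1 := fun h => by
    rw [kOp_mul, add_neg_cancel, kOp_zero]
  have heq : D.freeAct aP u = D.freeAct aP v →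
      D.freeAct aP u m - D.freeAct aP v m ∈ D.relSubmodule Z := fun h => by
    rw [h, sub_self]; exact Submodule.zero_mem _
  have hra : ∀ r, D.relator (fun x => D.freeAct aP (D.fa x)) r = 0 := fun r => by
    simp only [ha]; exact D.relator_aOp aP haP r
  have hrb : ∀ r, D.relator (fun x => D.freeAct aP (D.fb x)) r m ∈ D.relSubmodule Z := fun r => by
    simp only [hb]; exact D.word_relator_mem [] r m
  have hS : ∀ g i hi y, D.freeAct aP (D.serre g i hi y) =
      D.serreIn (fun x => D.freeAct aP (g x)) i hi y :=
    D.map_serre (R := Module.End (RatFunc ℚ) (D.Verma Z)) (D.freeAct aP)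
  have hC : ∀ g g' x y, D.freeAct aP (D.superComm g g' x y) = D.freeAct aP (g x) *
      D.freeAct aP (g' y) - D.sgn x y • (D.freeAct aP (g' y) * D.freeAct aP (g x)) :=
    D.map_superComm (R := Module.End (RatFunc ℚ) (D.Verma Z)) (D.freeAct aP)
  cases huv with
  | q_zero => exact heq (by rw [hq, kOp_zero, map_one])
  | q_add h h' => exact heq (by rw [map_mul, hq, hq, hq, kOp_mul])
  | q_a h x =>
    exact heq (by rw [map_mul, map_mul, map_smul, hq, hq, ha, kOp_mul_aOp, smul_mul_assoc,
      mul_assoc, hkk, mul_one]; rfl)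
  | q_b h x =>
    exact heq (by rw [map_mul, map_mul, map_smul, hq, hq, hb, kOp_mul_bOp, smul_mul_assoc,
      mul_assoc, hkk, mul_one]; rfl)
  | serre_a i hi y hy =>
    exact heq (by rw [hS, map_zero]; exact hra (.serre i hi y hy))
  | serre_b i hi y hy =>
    rw [hS, map_zero, LinearMap.zero_apply, sub_zero]
    exact hrb (.serre i hi y hy)
  | comm_a x y hxy =>
    exact heq (by rw [hC, map_zero]; exact hra (.comm x y hxy))
  | comm_b x y hxy =>
    rw [hC, map_zero, LinearMap.zero_apply, sub_zero]
    exact hrb (.comm x y hxy)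
  | ab_ne x y hxy =>
    exact heq (by
      rw [hC, map_zero, ha, hb, aOp_mul_bOp_of_ne _ _ _ _ hxy]
      exact sub_self (G := Module.End (RatFunc ℚ) (D.Verma Z)) _)
  | ab_self x =>
    exact heq (by
      rw [hC, map_smul, map_sub, hq, hq, ha, hb, aOp_mul_bOp_self]
      exact (add_sub_cancel_left (G := Module.End (RatFunc ℚ) (D.Verma Z)) _ _).trans
        (smul_sub (A := Module.End (RatFunc ℚ) (D.Verma Z)) _ _ _).symm)

/-- The action of `U_q(𝔤)` on the quotient of the induced module. -/
def act (haP : ∀ r, D.relator aP r = 0) :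
    D.U →ₐ[RatFunc ℚ] Module.End (RatFunc ℚ) (D.Verma Z ⧸ D.relSubmodule Z) :=
  RingQuot.liftAlgHom (RatFunc ℚ) ⟨D.freeActQuot aP, fun u v huv => by
    refine LinearMap.ext fun q => ?_
    obtain ⟨m, rfl⟩ := (D.relSubmodule Z).mkQ_surjective q
    rw [freeActQuot_mk, freeActQuot_mk, ← sub_eq_zero, ← map_sub, Submodule.mkQ_apply,
      Submodule.Quotient.mk_eq_zero]
    exact D.freeAct_rel aP haP huv m⟩

lemma act_gen_mk (haP : ∀ r, D.relator aP r = 0) (g : D.Gen) (m : D.Verma Z) :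
    D.act aP haP (D.gen g) ((D.relSubmodule Z).mkQ m) =
      (D.relSubmodule Z).mkQ (D.genOp aP g m) := by
  rw [← freeAct_ι, ← freeActQuot_mk, act, gen, mkU, RingQuot.liftAlgHom_mkAlgHom_apply]

end Quotient

/-! ### Evaluation of words in an algebra satisfying the negative relations. -/

section Projection

variable {A Z W : Type*} [Ring A] [Algebra (RatFunc ℚ) A] [Ring Z] [Algebra (RatFunc ℚ) Z]
  [AddCommGroup W] [Module (RatFunc ℚ) W] (bN : D.IInf → A)
  (j : Module.Dual ℤ P → Z →ₗ[RatFunc ℚ] W)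

/-- The evaluation of the words in the `b_{il}` in an algebra `A`. -/
def vermaProj : D.Verma Z →ₗ[RatFunc ℚ] A ⊗[RatFunc ℚ] W :=
  Finsupp.lsum (RatFunc ℚ) fun p => TensorProduct.mk (RatFunc ℚ) A W (p.1.map bN).prod ∘ₗ j p.2

lemma vermaProj_single (w : List D.IInf) (h : Module.Dual ℤ P) (z : Z) :
    D.vermaProj bN j (Finsupp.single (w, h) z) = (w.map bN).prod ⊗ₜ j h z := by
  rw [vermaProj, Finsupp.lsum_single]; rfl

lemma vermaProj_bOp (y : D.IInf) (m : D.Verma Z) :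
    D.vermaProj bN j (D.bOp Z y m) = bN y • D.vermaProj bN j m := by
  have : D.vermaProj bN j ∘ₗ D.bOp Z y =
      Algebra.lsmul (RatFunc ℚ) (RatFunc ℚ) (A ⊗[RatFunc ℚ] W) (bN y) ∘ₗ D.vermaProj bN j := by
    refine D.verma_ext fun w h z => ?_
    rw [LinearMap.comp_apply, LinearMap.comp_apply, bOp_single, vermaProj_single,
      vermaProj_single, List.map_cons, List.prod_cons]
    rfl
  exact LinearMap.congr_fun this m

/-- The projection intertwines `bOp` with left multiplication by `bN`, where the relators are zero.
-/
lemma relSubmodule_le_ker (hbN : ∀ r, D.relator bN r = 0) :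
    D.relSubmodule Z ≤ LinearMap.ker (D.vermaProj bN j) := by
  refine Submodule.span_le.2 ?_
  rintro _ ⟨w, r, m, rfl⟩
  change D.vermaProj bN j _ = 0
  induction w with
  | nil =>
    obtain ⟨c, -, hr⟩ := D.exists_relator_intertwine (f := D.vermaProj bN j) (g := D.bOp Z)
      (g' := fun y => Algebra.lsmul (RatFunc ℚ) (RatFunc ℚ) (A ⊗[RatFunc ℚ] W) (bN y))
      (χ := fun _ => 1) (fun _ => one_ne_zero)
      (fun y m => by rw [vermaProj_bOp, one_smul]; rfl) r
    have h1 := D.map_relator (R' := Module.End (RatFunc ℚ) (A ⊗[RatFunc ℚ] W))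
      (Algebra.lsmul (RatFunc ℚ) (RatFunc ℚ) (A ⊗[RatFunc ℚ] W)) bN r
    rw [hbN, map_zero] at h1
    rw [List.map_nil, List.prod_nil, Module.End.one_apply, hr, ← h1, LinearMap.zero_apply,
      smul_zero]
  | cons y w ih =>
    rw [List.map_cons, List.prod_cons, Module.End.mul_apply, vermaProj_bOp, ih, smul_zero]

/-- The descent of `vermaProj` to the quotient. -/
def quotProj (hbN : ∀ r, D.relator bN r = 0) :
    (D.Verma Z ⧸ D.relSubmodule Z) →ₗ[RatFunc ℚ] A ⊗[RatFunc ℚ] W :=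
  (D.relSubmodule Z).liftQ (D.vermaProj bN j) (D.relSubmodule_le_ker bN j hbN)

lemma quotProj_mk (hbN : ∀ r, D.relator bN r = 0) (m : D.Verma Z) :
    D.quotProj bN j hbN ((D.relSubmodule Z).mkQ m) = D.vermaProj bN j m :=
  (D.relSubmodule Z).liftQ_apply _ m

end Projection

/-! ### Straightening words, with control of parity. -/

section Surjectivity

/-- The span of the ordered words (a word in the `b_{il}`, then some `q^h`, then a word in the
`a_{il}`) of total parity `c`. -/
def orderedSpan (c : ZMod 2) : Submodule (RatFunc ℚ) D.U :=
  Submodule.span _ {u | ∃ (v : List D.IInf) (h : Module.Dual ℤ P) (w : List D.IInf),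
    (v.map fun x => D.genParity (.b x)).sum + (w.map fun x => D.genParity (.a x)).sum = c ∧
      (v.map fun x => D.gen (.b x)).prod * D.gen (.qpow h) *
        (w.map fun x => D.gen (.a x)).prod = u}

lemma ordered_mem (v : List D.IInf) (h : Module.Dual ℤ P) (w : List D.IInf) :
    (v.map fun x => D.gen (.b x)).prod * D.gen (.qpow h) * (w.map fun x => D.gen (.a x)).prod ∈
      D.orderedSpan ((v.map fun x => D.genParity (.b x)).sum +
        (w.map fun x => D.genParity (.a x)).sum) :=
  Submodule.subset_span ⟨v, h, w, rfl, rfl⟩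

/-- To show that left multiplication by `g` maps ordered words of parity `c` into a family of
submodules, it suffices to look at generators of the span. -/
lemma mul_mem_of_ordered {g : D.U} {c c' : ZMod 2}
    (hg : ∀ (v : List D.IInf) (h : Module.Dual ℤ P) (w : List D.IInf),
      (v.map fun x => D.genParity (.b x)).sum + (w.map fun x => D.genParity (.a x)).sum = c →
      g * ((v.map fun x => D.gen (.b x)).prod * D.gen (.qpow h) *
        (w.map fun x => D.gen (.a x)).prod) ∈ D.orderedSpan c') {u : D.U}
    (hu : u ∈ D.orderedSpan c) : g * u ∈ D.orderedSpan c' := by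
  have : D.orderedSpan c ≤ (D.orderedSpan c').comap (LinearMap.mulLeft (RatFunc ℚ) g) := by
    refine Submodule.span_le.2 ?_
    rintro _ ⟨v, h, w, hc, rfl⟩
    exact hg v h w hc
  exact this hu

lemma b_mul_mem (y : D.IInf) {c : ZMod 2} {u : D.U} (hu : u ∈ D.orderedSpan c) :
    D.gen (.b y) * u ∈ D.orderedSpan (D.genParity (.b y) + c) := by
  refine D.mul_mem_of_ordered (fun v h w hc => ?_) hu
  have := D.ordered_mem (y :: v) h w
  rw [List.map_cons, List.sum_cons, List.map_cons, List.prod_cons, add_assoc, hc] at this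
  simpa only [mul_assoc] using this

lemma q_mul_mem (h : Module.Dual ℤ P) {c : ZMod 2} {u : D.U} (hu : u ∈ D.orderedSpan c) :
    D.gen (.qpow h) * u ∈ D.orderedSpan c := by
  refine D.mul_mem_of_ordered (fun v h' w hc => ?_) hu
  subst hc
  clear hu
  induction v with
  | nil =>
    have := D.ordered_mem [] (h + h') w
    rw [← gen_q_mul] at this
    simpa only [List.map_nil, List.prod_nil, one_mul, mul_assoc] using this
  | cons y v ih =>
    have hk : D.gen (.qpow h) * D.gen (.b y) =
        (RatFunc.X ^ (-D.wt y h) : RatFunc ℚ) • (D.gen (.b y) * D.gen (.qpow h)) := D.uRep.k_b h y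
    have := D.b_mul_mem y ih
    rw [List.map_cons, List.map_cons, List.prod_cons, List.sum_cons, mul_assoc, mul_assoc,
      ← mul_assoc, hk, smul_mul_assoc, add_assoc]
    refine Submodule.smul_mem _ _ ?_
    simpa only [mul_assoc] using this

lemma genParity_self_add (x : D.IInf) (c : ZMod 2) :
    D.genParity (.a x) + (D.genParity (.b x) + c) = c := by
  rw [← add_assoc]
  exact (congrArg (· + c) (CharTwo.add_self_eq_zero _)).trans (zero_add c)

/-- Moving `a_x` past a letter `b_y` leaves a correction only for `x = y`: a `q^h` times a shorter
ordered word. The parity is unchanged because the two lost letters have equal parity. -/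
lemma a_mul_mem (x : D.IInf) {c : ZMod 2} {u : D.U} (hu : u ∈ D.orderedSpan c) :
    D.gen (.a x) * u ∈ D.orderedSpan (D.genParity (.a x) + c) := by
  refine D.mul_mem_of_ordered (fun v h w hc => ?_) hu
  subst hc
  clear hu
  induction v with
  | nil =>
    have hk : D.gen (.a x) * D.gen (.qpow h) =
        (RatFunc.X ^ (-D.wt x h) : RatFunc ℚ) • (D.gen (.qpow h) * D.gen (.a x)) := by
      rw [show D.gen (.qpow h) * D.gen (.a x) = _ from D.uRep.k_a h x, smul_smul,
        ← zpow_add₀ RatFunc.X_ne_zero, neg_add_cancel, zpow_zero, one_smul]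
      rfl
    have := D.ordered_mem [] h (x :: w)
    rw [List.map_nil, List.map_nil, List.prod_nil, one_mul, ← mul_assoc, hk, smul_mul_assoc]
    refine Submodule.smul_mem _ _ ?_
    simpa [mul_assoc] using this
  | cons y v ih =>
    set m := (v.map fun x => D.gen (.b x)).prod * D.gen (.qpow h) *
      (w.map fun x => D.gen (.a x)).prod with hm
    have hm' := D.ordered_mem v h w
    rw [← hm] at hm'
    have e : ((y :: v).map fun x => D.gen (.b x)).prod * D.gen (.qpow h) *
        (w.map fun x => D.gen (.a x)).prod = D.gen (.b y) * m := by
      rw [List.map_cons, List.prod_cons, hm]; simp only [mul_assoc]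
    have hb := D.b_mul_mem y ih
    rw [add_left_comm, ← mul_assoc] at hb
    rw [e, List.map_cons, List.sum_cons, add_assoc, ← mul_assoc]
    by_cases hxy : x = y
    · subst hxy
      rw [show D.gen (.a x) * D.gen (.b x) = _ from D.uRep.ab_self x, add_mul, sub_mul,
        smul_mul_assoc, smul_mul_assoc, smul_mul_assoc]
      refine Submodule.add_mem _ (Submodule.smul_mem _ _ hb) ?_
      rw [genParity_self_add]
      exact Submodule.sub_mem _ (Submodule.smul_mem _ _ (D.q_mul_mem _ hm'))
        (Submodule.smul_mem _ _ (D.q_mul_mem _ hm'))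
    · rw [show D.gen (.a x) * D.gen (.b y) = _ from D.uRep.ab_ne x y hxy, smul_mul_assoc]
      exact Submodule.smul_mem _ _ hb

lemma parity_le_orderedSpan (c : ZMod 2) : D.parity c ≤ D.orderedSpan c := by
  refine Submodule.span_le.2 ?_
  rintro _ ⟨w, rfl, rfl⟩
  change _ ∈ D.orderedSpan _
  induction w with
  | nil =>
    have := D.ordered_mem [] 0 []
    simpa [gen_q_zero] using this
  | cons g w ih =>
    rw [List.map_cons, List.map_cons, List.prod_cons, List.sum_cons]
    cases g with
    | a x => exact D.a_mul_mem x ih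
    | b x => exact D.b_mul_mem x ih
    | qpow h => exact (zero_add (w.map D.genParity).sum).symm ▸ D.q_mul_mem h ih

end Surjectivity

/-! ### The multiplication map and its left inverse. -/

section Multiplication

/-- The multiplication map `U^- ⊗ U^0 ⊗ U^+ → U`. -/
def triMul : D.UNeg ⊗[RatFunc ℚ] (D.UZero ⊗[RatFunc ℚ] D.UPos) →ₗ[RatFunc ℚ] D.U :=
  LinearMap.mul' (RatFunc ℚ) D.U ∘ₗ TensorProduct.map D.UNeg.val.toLinearMap
    (LinearMap.mul' (RatFunc ℚ) D.U ∘ₗ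
      TensorProduct.map D.UZero.val.toLinearMap D.UPos.val.toLinearMap)

lemma triMul_tmul (x : D.UNeg) (y : D.UZero) (z : D.UPos) :
    D.triMul (x ⊗ₜ (y ⊗ₜ z)) = (x : D.U) * (y : D.U) * (z : D.U) := by
  rw [mul_assoc]; rfl

lemma word_mem_parity (f : D.IInf → D.Gen) (v : List D.IInf) :
    (v.map fun x => D.gen (f x)).prod ∈ D.parity (v.map fun x => D.genParity (f x)).sum :=
  Submodule.subset_span ⟨v.map f, by simp [Function.comp_def], by simp [Function.comp_def]⟩

lemma map_tensorParity (c : ZMod 2) : (D.tensorParity c).map D.triMul = D.parity c := by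
  apply le_antisymm
  · rw [tensorParity, Submodule.map_span, Submodule.span_le]
    rintro _ ⟨_, ⟨c₁, c₂, c₃, x, y, z, rfl, hx, hy, hz, rfl⟩, rfl⟩
    rw [triMul_tmul]
    exact SetLike.mul_mem_graded (SetLike.mul_mem_graded hx hy) hz
  · refine (D.parity_le_orderedSpan c).trans (Submodule.span_le.2 ?_)
    rintro _ ⟨v, h, w, rfl, rfl⟩
    have hv : (v.map fun x => D.gen (.b x)).prod ∈ D.UNeg :=
      Subalgebra.list_prod_mem _ fun u hu => by
        obtain ⟨x, -, rfl⟩ := List.mem_map.1 hu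
        exact (D.bNeg x).2
    have hw : (w.map fun x => D.gen (.a x)).prod ∈ D.UPos :=
      Subalgebra.list_prod_mem _ fun u hu => by
        obtain ⟨x, -, rfl⟩ := List.mem_map.1 hu
        exact (D.aPos x).2
    refine ⟨⟨_, hv⟩ ⊗ₜ (D.qZero h ⊗ₜ ⟨_, hw⟩), Submodule.subset_span
      ⟨_, 0, _, ⟨_, hv⟩, D.qZero h, ⟨_, hw⟩, ?_, D.word_mem_parity _ v, D.gen_mem (.qpow h),
        D.word_mem_parity _ w, rfl⟩, D.triMul_tmul _ _ _⟩
    rw [add_zero]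

lemma triMul_surjective : Function.Surjective D.triMul := by
  rw [← LinearMap.range_eq_top, eq_top_iff,
    ← (DirectSum.Decomposition.isInternal D.parity).submodule_iSup_eq_top]
  refine iSup_le fun c => ?_
  rw [← map_tensorParity]
  exact LinearMap.map_le_range

/-- The `q^h` contain `1` and are closed under products, so their span is already a subalgebra. -/
lemma mem_UZero_span {y : D.U} (hy : y ∈ D.UZero) :
    y ∈ Submodule.span (RatFunc ℚ) (Set.range fun h => D.gen (.qpow h)) := by
  induction hy using Algebra.adjoin_induction with
  | mem y h => exact Submodule.subset_span h
  | algebraMap c =>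
    rw [Algebra.algebraMap_eq_smul_one, ← gen_q_zero]
    exact Submodule.smul_mem _ _ (Submodule.subset_span ⟨0, rfl⟩)
  | add y y' _ _ h h' => exact Submodule.add_mem _ h h'
  | mul y y' _ _ h h' =>
    have := Submodule.mul_mem_mul h h'
    rw [Submodule.span_mul_span] at this
    refine Submodule.span_mono ?_ this
    rintro _ ⟨_, ⟨h, rfl⟩, _, ⟨h', rfl⟩, rfl⟩
    exact ⟨h + h', (D.gen_q_mul h h').symm⟩

/-- The map `z ↦ q^h ⊗ z`. -/
def tmulLeft (h : Module.Dual ℤ P) :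
    D.UPos →ₗ[RatFunc ℚ] (D.UZero ⊗[RatFunc ℚ] D.UPos) :=
  TensorProduct.mk (RatFunc ℚ) D.UZero D.UPos (D.qZero h)

/-- The quotient of the induced module for `Z = U^+`. -/
abbrev VermaQuot : Type (max u v) := D.Verma D.UPos ⧸ D.relSubmodule D.UPos

/-- The class of `1 ⊗ q^h ⊗ z`. -/
def vermaVec (h : Module.Dual ℤ P) : D.UPos →ₗ[RatFunc ℚ] D.VermaQuot :=
  (D.relSubmodule D.UPos).mkQ ∘ₗ Finsupp.lsingle ([], h)

/-- The action of `U_q(𝔤)` on `VermaQuot`. -/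
def uAct : D.U →ₐ[RatFunc ℚ] Module.End (RatFunc ℚ) D.VermaQuot := D.act D.aPos D.relator_aPos

/-- The projection of `VermaQuot` to `U^- ⊗ U^0 ⊗ U^+`. -/
def uProj : D.VermaQuot →ₗ[RatFunc ℚ] D.UNeg ⊗[RatFunc ℚ] (D.UZero ⊗[RatFunc ℚ] D.UPos) :=
  D.quotProj D.bNeg D.tmulLeft D.relator_bNeg

lemma uAct_gen (g : D.Gen) (m : D.Verma D.UPos) :
    D.uAct (D.gen g) ((D.relSubmodule D.UPos).mkQ m) =
      (D.relSubmodule D.UPos).mkQ (D.genOp D.aPos g m) :=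
  D.act_gen_mk D.aPos D.relator_aPos g m

/-- At `h = 0` the weight twist in the action of `a` is trivial, so `U^+` acts exactly by left
multiplication. -/
lemma uAct_UPos (z z' : D.UPos) :
    D.uAct (z : D.U) (D.vermaVec 0 z') = D.vermaVec 0 (z * z') := by
  obtain ⟨z, hz⟩ := z
  induction hz using Algebra.adjoin_induction generalizing z' with
  | mem u h =>
    obtain ⟨x, rfl⟩ := h
    refine (D.uAct_gen (.a x) (Finsupp.single ([], 0) z')).trans ?_
    have h1 := D.aOp_single_nil D.aPos x 0 z'
    rw [wt_zero, neg_zero, zpow_zero, one_smul] at h1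
    exact congrArg (D.relSubmodule D.UPos).mkQ h1
  | algebraMap c =>
    have h1 : D.uAct (algebraMap (RatFunc ℚ) D.U c) (D.vermaVec 0 z') = c • D.vermaVec 0 z' := by
      rw [AlgHom.commutes, Module.algebraMap_end_apply]
    refine h1.trans ((map_smul (D.vermaVec 0) c z').symm.trans (congrArg _ ?_))
    exact Algebra.smul_def c z'
  | add u v hu hv h h' =>
    have h1 : D.uAct (u + v) (D.vermaVec 0 z') =
        D.uAct u (D.vermaVec 0 z') + D.uAct v (D.vermaVec 0 z') := by
      rw [map_add, LinearMap.add_apply]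
    refine h1.trans ?_
    rw [h z', h' z']
    exact (map_add (D.vermaVec 0) _ _).symm.trans
      (congrArg _ (add_mul (⟨u, hu⟩ : D.UPos) ⟨v, hv⟩ z').symm)
  | mul u v hu hv h h' =>
    have h1 : D.uAct (u * v) (D.vermaVec 0 z') = D.uAct u (D.uAct v (D.vermaVec 0 z')) := by
      rw [map_mul, Module.End.mul_apply]
    refine h1.trans ?_
    rw [h' z', h]
    exact congrArg _ (mul_assoc (⟨u, hu⟩ : D.UPos) ⟨v, hv⟩ z').symm

lemma uProj_uAct_q (h : Module.Dual ℤ P) (z : D.UPos) :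
    D.uProj (D.uAct (D.gen (.qpow h)) (D.vermaVec 0 z)) = 1 ⊗ₜ (D.qZero h ⊗ₜ z) := by
  have h1 := D.uAct_gen (.qpow h) (Finsupp.single ([], 0) z)
  have h2 : D.genOp D.aPos (.qpow h) (Finsupp.single ([], 0) z) = Finsupp.single ([], h) z := by
    refine (D.kOp_single h [] 0 z).trans ?_
    rw [show D.wordWt [] h = 0 from rfl, neg_zero, zpow_zero, one_smul, add_zero]
  rw [h2] at h1
  refine (congrArg D.uProj h1).trans ?_
  refine (D.quotProj_mk D.bNeg D.tmulLeft D.relator_bNeg _).trans ?_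
  exact D.vermaProj_single D.bNeg D.tmulLeft [] h z

lemma uProj_uAct_UZero (y : D.UZero) (z : D.UPos) :
    D.uProj (D.uAct (y : D.U) (D.vermaVec 0 z)) = 1 ⊗ₜ (y ⊗ₜ z) := by
  set f : D.U →ₗ[RatFunc ℚ] D.UNeg ⊗[RatFunc ℚ] (D.UZero ⊗[RatFunc ℚ] D.UPos) :=
    D.uProj ∘ₗ LinearMap.applyₗ (D.vermaVec 0 z) ∘ₗ D.uAct.toLinearMap
  set g : D.UZero →ₗ[RatFunc ℚ] D.UNeg ⊗[RatFunc ℚ] (D.UZero ⊗[RatFunc ℚ] D.UPos) :=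
    TensorProduct.mk (RatFunc ℚ) D.UNeg (D.UZero ⊗[RatFunc ℚ] D.UPos) 1 ∘ₗ
      (TensorProduct.mk (RatFunc ℚ) D.UZero D.UPos).flip z
  -- Both sides are linear in `y`, so the case `y = q^h` suffices; membership in `U^0` is carried
  -- along so that `g` can be applied during the induction.
  have key : ∀ u ∈ Submodule.span (RatFunc ℚ) (Set.range fun h => D.gen (.qpow h)),
      ∃ hu : u ∈ D.UZero, f u = g ⟨u, hu⟩ := by
    intro u hu
    induction hu using Submodule.span_induction with
    | mem u h =>
      obtain ⟨h, rfl⟩ := h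
      exact ⟨(D.qZero h).2, D.uProj_uAct_q h z⟩
    | zero => exact ⟨D.UZero.zero_mem, (LinearMap.map_zero f).trans (LinearMap.map_zero g).symm⟩
    | add u v _ _ hu hv =>
      obtain ⟨hu, h1⟩ := hu
      obtain ⟨hv, h2⟩ := hv
      refine ⟨D.UZero.add_mem hu hv, ?_⟩
      rw [LinearMap.map_add, h1, h2]
      exact (LinearMap.map_add g _ _).symm
    | smul c u _ hu =>
      obtain ⟨hu, h1⟩ := hu
      refine ⟨D.UZero.smul_mem hu c, ?_⟩
      rw [LinearMap.map_smul, h1]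
      exact (LinearMap.map_smul g _ _).symm
  exact (key y (D.mem_UZero_span y.2)).2

lemma uProj_uAct_UNeg (x : D.UNeg) (m : D.VermaQuot) :
    D.uProj (D.uAct (x : D.U) m) = x • D.uProj m := by
  obtain ⟨x, hx⟩ := x
  induction hx using Algebra.adjoin_induction generalizing m with
  | mem u h =>
    obtain ⟨y, rfl⟩ := h
    obtain ⟨m, rfl⟩ := (D.relSubmodule D.UPos).mkQ_surjective m
    refine (congrArg D.uProj (D.uAct_gen (.b y) m)).trans ?_
    refine (D.quotProj_mk D.bNeg D.tmulLeft D.relator_bNeg _).trans ?_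
    refine (D.vermaProj_bOp D.bNeg D.tmulLeft y m).trans ?_
    exact congrArg (D.bNeg y • ·) (D.quotProj_mk D.bNeg D.tmulLeft D.relator_bNeg m).symm
  | algebraMap c =>
    have h1 : D.uAct (algebraMap (RatFunc ℚ) D.U c) m = c • m := by
      rw [AlgHom.commutes, Module.algebraMap_end_apply]
    refine (congrArg D.uProj h1).trans ((LinearMap.map_smul D.uProj c m).trans ?_)
    exact (algebraMap_smul D.UNeg c (D.uProj m)).symm
  | add u v hu hv h h' =>
    have h1 : D.uAct (u + v) m = D.uAct u m + D.uAct v m := by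
      rw [map_add, LinearMap.add_apply]
    refine (congrArg D.uProj h1).trans ((LinearMap.map_add D.uProj _ _).trans ?_)
    rw [h m, h' m]
    exact (add_smul (⟨u, hu⟩ : D.UNeg) ⟨v, hv⟩ (D.uProj m)).symm
  | mul u v hu hv h h' =>
    have h1 : D.uAct (u * v) m = D.uAct u (D.uAct v m) := by
      rw [map_mul, Module.End.mul_apply]
    refine (congrArg D.uProj h1).trans ?_
    rw [h, h']
    exact (mul_smul (⟨u, hu⟩ : D.UNeg) ⟨v, hv⟩ (D.uProj m)).symm

/-- The left inverse of the multiplication map. -/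
def triSplit : D.U →ₗ[RatFunc ℚ] D.UNeg ⊗[RatFunc ℚ] (D.UZero ⊗[RatFunc ℚ] D.UPos) :=
  D.uProj ∘ₗ LinearMap.applyₗ (D.vermaVec 0 1) ∘ₗ D.uAct.toLinearMap

/-- Acting in turn on the class of `1 ⊗ 1 ⊗ 1`, `z` fills the third slot, `y` the second after
projection, and `x` multiplies the first. -/
lemma triSplit_triMul : D.triSplit ∘ₗ D.triMul = LinearMap.id := by
  refine TensorProduct.ext' fun x t => ?_
  induction t with
  | zero => rw [TensorProduct.tmul_zero, LinearMap.map_zero, LinearMap.map_zero]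
  | add t t' h h' => rw [TensorProduct.tmul_add, LinearMap.map_add, LinearMap.map_add, h, h']
  | tmul y z =>
    have h1 : D.triSplit (D.triMul (x ⊗ₜ (y ⊗ₜ z))) =
        D.uProj (D.uAct ((x : D.U) * (y : D.U) * (z : D.U)) (D.vermaVec 0 1)) := by
      rw [triMul_tmul]; rfl
    rw [LinearMap.comp_apply, h1, map_mul, map_mul, Module.End.mul_apply, Module.End.mul_apply,
      uAct_UPos, mul_one, uProj_uAct_UNeg, uProj_uAct_UZero, TensorProduct.smul_tmul', smul_eq_mul,
      mul_one, LinearMap.id_apply]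

end Multiplication

end SuperBorcherdsCartanDatum

theorem mainTheorem4 {I : Type*} {P : Type*} [AddCommGroup P] [Module.Free ℤ P]
    (D : SuperBorcherdsCartanDatum I P) :
    ∃ e : (D.UNeg ⊗[RatFunc ℚ] (D.UZero ⊗[RatFunc ℚ] D.UPos)) ≃ₗ[RatFunc ℚ] D.U,
      (∀ (x : D.UNeg) (y : D.UZero) (z : D.UPos),
        e (x ⊗ₜ (y ⊗ₜ z)) = (x : D.U) * (y : D.U) * (z : D.U)) ∧
      ∀ c : ZMod 2, (D.tensorParity c).map (e : _ →ₗ[RatFunc ℚ] D.U) = D.parity c := by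
  refine ⟨LinearEquiv.ofBijective D.triMul ⟨?_, D.triMul_surjective⟩, D.triMul_tmul,
    D.map_tensorParity⟩
  exact Function.LeftInverse.injective (g := D.triSplit) (LinearMap.congr_fun D.triSplit_triMul)

end
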